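/- Let $\lambda,\mu\ge 0$ be real numbers, not both zero. Write $\hat f(\xi,\eta)=\int_{\mathbb R^2} e^{-2\pi i(x\xi+y\eta)}f(x,y)\,dx\,dy$ for the Fourier transform on $L^2=L^2(\mathbb R^2)$ (real- or complex-valued functions), and let $D_x^{1/2}$, $D_x^{-1/2}\partial_y$, $\partial_x^{-1}\partial_y$ be the Fourier multipliers with symbols $|2\pi\xi|^{1/2}$, $|2\pi\xi|^{-1/2}\,2\pi i\eta$, $\eta/\xi$. Let $X=X^{1/2}$ be the space of all $f\in L^2$ with $D_x^{1/2}f\in L^2$, with $D_x^{-1/2}\partial_y f\in L^2$ if $\lambda\neq 0$, and with $\partial_x^{-1}\partial_y f\in L^2$ if $\mu\ne 0$, normed by $$\|f\|_X^2=\|f\|_{L^2}^2+\|D_x^{1/2}f\|_{L^2}^2+\lambda\|D_x^{-1/2}\partial_y f\|_{L^2}^2+\mu\|\partial_x^{-1}\partial_y f\|_{L^2}^2 ,$$ where a term with coefficient $0$ is omitted. For an open set $\Omega\subseteq\mathbb R^2$ let $X(\Omega)$ be the set of restrictions $g|_\Omega\in L^2(\Omega)$ of elements $g\in X$, with the norm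 $\|f\|_{X(\Omega)}=\inf\{\|g\|_X : g\in X,\ g|_\Omega=f\}$. Theorem. For every $R>0$ there is a constant $C>0$, depending only on $R,\lambda,\mu$, such that the following holds. Let $\{\Omega_i\}_{i\in\mathbb N}$ be open squares with edges parallel to the coordinate axes and side length $R$ that cover $\mathbb R^2$ and are such that every point of $\mathbb R^2$ lies in $\Omega_i$ for at most $3$ indices $i$. Then for every $u\in X$ each restriction $u|_{\Omega_i}$ belongs to $X(\Omega_i)$, and $$\sum_{i=0}^\infty\|u|_{\Omega_i}\|_{X(\Omega_i)}^2\le C\,\|u\|_X^2 .$$ -/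

import Mathlib

open MeasureTheory
open scoped FourierTransform

noncomputable section

namespace AnisotropicX

/-- The plane `ℝ²` with its Euclidean structure; a point is `z`, with `x = z 0` and `y = z 1`. -/
abbrev Plane : Type := EuclideanSpace ℝ (Fin 2)

/-- `L²(ℝ²)`, with values in `𝕜 = ℝ` or `𝕜 = ℂ`. -/
abbrev L2 (𝕜 : Type*) [RCLike 𝕜] : Type _ := Lp (α := Plane) 𝕜 2 volume

/-- `L²(Ω)` for a set `Ω ⊆ ℝ²`. -/
abbrev L2On (𝕜 : Type*) [RCLike 𝕜] (Ω : Set Plane) : Type _ :=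
  Lp (α := Plane) 𝕜 2 (volume.restrict Ω)

/-- The restriction `f ↦ f|_Ω` from `L²(ℝ²)` to `L²(Ω)`. -/
def restrictL2 {𝕜 : Type*} [RCLike 𝕜] (Ω : Set Plane) (f : L2 𝕜) : L2On 𝕜 Ω :=
  LpToLpRestrictCLM Plane 𝕜 𝕜 volume 2 Ω f

/-- A real or complex `L²` function regarded as a complex `L²` function. -/
def toComplex {𝕜 : Type*} [RCLike 𝕜] (f : L2 𝕜) : L2 ℂ := (RCLike.map 𝕜 ℂ).compLp f

/-- The Fourier transform (normalized as `∫ e^{-2πi⟨z,ζ⟩} f(z) dz`) of `f ∈ L²(ℝ²)`. -/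
def hat {𝕜 : Type*} [RCLike 𝕜] (f : L2 𝕜) : L2 ℂ := 𝓕 (toComplex f)

/-- `m(D) f ∈ L²(ℝ²)`, where `m(D)` is the Fourier multiplier with symbol `m`. -/
def MultiplierMem {𝕜 : Type*} [RCLike 𝕜] (m : Plane → ℂ) (f : L2 𝕜) : Prop :=
  MemLp (fun ζ : Plane => m ζ * hat f ζ) 2 volume

open Classical in
/-- `m(D) f = (m f̂)^∨` as an element of `L²(ℝ²)`; it is meant for `f` with `MultiplierMem m f`
and is set to `0` for other `f`. -/
def multiplier {𝕜 : Type*} [RCLike 𝕜] (m : Plane → ℂ) (f : L2 𝕜) : L2 ℂ :=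
  if h : MultiplierMem m f then 𝓕⁻ (MemLp.toLp (fun ζ : Plane => m ζ * hat f ζ) h) else 0

/-- The symbol `|2πξ|^s` of `D_x^s`, `ζ = (ξ, η)`. -/
def symbolDx (s : ℝ) (ζ : Plane) : ℂ := (((2 * Real.pi * |ζ 0|) ^ s : ℝ) : ℂ)

/-- The symbol `2πiξ` of `∂_x`. -/
def symbolPartialX (ζ : Plane) : ℂ := 2 * Real.pi * Complex.I * (ζ 0 : ℂ)

/-- The symbol `2πiη` of `∂_y`. -/
def symbolPartialY (ζ : Plane) : ℂ := 2 * Real.pi * Complex.I * (ζ 1 : ℂ)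

/-- The symbol of `D_x^{1/2}`. -/
def symbolA (ζ : Plane) : ℂ := symbolDx (1 / 2) ζ

/-- The symbol of `D_x^{-1/2} ∂_y`. -/
def symbolB (ζ : Plane) : ℂ := symbolDx (-(1 / 2)) ζ * symbolPartialY ζ

/-- The symbol of `∂_x^{-1} ∂_y`. -/
def symbolC (ζ : Plane) : ℂ := (symbolPartialX ζ)⁻¹ * symbolPartialY ζ

/-- The space `X^{1/2}` attached to the coefficients `lam, mu ≥ 0`: the `f ∈ L²` with
`D_x^{1/2} f ∈ L²`, with `D_x^{-1/2} f_y ∈ L²` if `lam ≠ 0`, and with `∂_x^{-1} f_y ∈ L²` if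
`mu ≠ 0`.  Thus `lam ≠ 0, mu = 0` gives `{f ∈ L² | D_x^{1/2} f, D_x^{-1/2} f_y ∈ L²}` and
`lam = 0, mu ≠ 0` gives `{f ∈ L² | D_x^{1/2} f, ∂_x^{-1} f_y ∈ L²}`. -/
def XSpace (𝕜 : Type*) [RCLike 𝕜] (lam mu : ℝ) : Set (L2 𝕜) :=
  {f | MultiplierMem symbolA f ∧ (lam ≠ 0 → MultiplierMem symbolB f) ∧
    (mu ≠ 0 → MultiplierMem symbolC f)}

/-- The norm of `X^{1/2}`: the square root of
`‖f‖² + ‖D_x^{1/2} f‖² + lam ‖D_x^{-1/2} f_y‖² + mu ‖∂_x^{-1} f_y‖²` (norms in `L²`). -/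
def XNorm {𝕜 : Type*} [RCLike 𝕜] (lam mu : ℝ) (f : L2 𝕜) : ℝ :=
  Real.sqrt (‖f‖ ^ 2 + ‖multiplier symbolA f‖ ^ 2 + lam * ‖multiplier symbolB f‖ ^ 2
    + mu * ‖multiplier symbolC f‖ ^ 2)

/-- The space `X^{1/2}(Ω)` of the `f ∈ L²(Ω)` that are restrictions of elements of `X^{1/2}`. -/
def XSpaceOn (𝕜 : Type*) [RCLike 𝕜] (lam mu : ℝ) (Ω : Set Plane) : Set (L2On 𝕜 Ω) :=
  restrictL2 Ω '' XSpace 𝕜 lam mu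

/-- The quotient norm of `X^{1/2}(Ω)`: the infimum of `‖g‖_{X^{1/2}}` over all `g ∈ X^{1/2}`
with `g|_Ω = f`. -/
def XNormOn {𝕜 : Type*} [RCLike 𝕜] (lam mu : ℝ) (Ω : Set Plane) (f : L2On 𝕜 Ω) : ℝ :=
  sInf {t : ℝ | ∃ g ∈ XSpace 𝕜 lam mu, restrictL2 Ω g = f ∧ t = XNorm lam mu g}

/-- The open axis-parallel square with lower left corner `c` and side `R`. -/
def square (c : Plane) (R : ℝ) : Set Plane := {z | ∀ j : Fin 2, c j < z j ∧ z j < c j + R}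

end AnisotropicX

end

/-! The natural extension of `u` from a square is `χ_i u`, with a smooth cutoff `χ_i` equal to 1 on
the square. It may fail to lie in `X`: its `x`-integrals need not vanish, and the symbols of
`D_x^{-1/2} ∂_y` and `∂_x^{-1} ∂_y` are singular at `ξ = 0`. The remedy is to subtract a horizontal
translate, `g_i = χ_i u - (χ_i u)(· - (L, 0))` with `L = 3R`. The translate vanishes on the square,
so `g_i` still extends `u`, while the Fourier factor `1 - e^{-2πiLξ}` is bounded by 2 and by
`L|2πξ|`, which absorbs the singularity.

It remains to bound `∑ ‖g_i‖_X²`. The cutoffs and their derivatives have bounded overlap, so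
Plancherel controls `∑ ‖χ_i f‖²` by `‖f‖²`. If `∂_y u = ∂_x v` with `v` in `L²`, then `χ ∂_y u =
∂_x(χ v) - (∂_x χ) v`; together with `∂_y(χ u) = χ ∂_y u + (∂_y χ) u` this settles the `μ` term
(`tsum_lintegral_absShift_div_sq_cutDeriv_le`).

The two half-order terms follow by real interpolation, done by hand in
`tsum_lintegral_interpolation`: `D_x^{1/2}` lies between orders 0 and 1 in `x`, and `D_x^{-1/2} ∂_y`
between `∂_y` and `∂_x^{-1} ∂_y`. The sum over `i` is carried through the interpolation, so no
orthogonality of the nonlocal pieces is needed. -/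

namespace AnisotropicX

open scoped SchwartzMap LineDeriv ENNReal

/-! ### Cutoffs and the product rule on the Fourier side -/

/-- The symbol `2πiζ_j` of `∂_j`. -/
noncomputable def symbolPartial (j : Fin 2) (ζ : Plane) : ℂ :=
  2 * Real.pi * Complex.I * (ζ j : ℂ)

theorem continuous_symbolPartial (j : Fin 2) : Continuous (symbolPartial j) := by
  unfold symbolPartial; fun_prop

/-- The `j`-th unit vector. -/
noncomputable def unitVec (j : Fin 2) : Plane := EuclideanSpace.single j 1

theorem inner_unitVec (ζ : Plane) (j : Fin 2) : inner ℝ ζ (unitVec j) = ζ j := by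
  simp [unitVec, EuclideanSpace.inner_single_right]

theorem memLp_schwartz_mul (χ : 𝓢(Plane, ℂ)) (f : L2 ℂ) :
    MemLp (fun z => χ z * f z) 2 volume :=
  (Lp.memLp f).mul (p := ⊤) (χ.memLp ⊤ volume)

/-- Multiplication of an `L²` function by a Schwartz function. -/
noncomputable def cut (χ : 𝓢(Plane, ℂ)) (f : L2 ℂ) : L2 ℂ := (memLp_schwartz_mul χ f).toLp _

theorem coeFn_cut (χ : 𝓢(Plane, ℂ)) (f : L2 ℂ) : cut χ f =ᵐ[volume] fun z => χ z * f z :=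
  MemLp.coeFn_toLp _

theorem cut_add (χ : 𝓢(Plane, ℂ)) (f g : L2 ℂ) : cut χ (f + g) = cut χ f + cut χ g := by
  apply Lp.ext
  filter_upwards [coeFn_cut χ f, coeFn_cut χ g, coeFn_cut χ (f + g), Lp.coeFn_add f g,
    Lp.coeFn_add (cut χ f) (cut χ g)] with z h1 h2 h3 h4 h5
  rw [h3, h5, h4, Pi.add_apply, Pi.add_apply, h1, h2, mul_add]

theorem integral_fourier_mul_schwartz (f : L2 ℂ) (ρ : 𝓢(Plane, ℂ)) :
    ∫ ζ, ρ ζ * (𝓕 f : L2 ℂ) ζ = ∫ z, (𝓕 ρ) z * f z := by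
  have h := congrArg (fun T => T ρ) (Lp.fourier_toTemperedDistribution_eq f)
  simp only [TemperedDistribution.fourier_apply, Lp.toTemperedDistribution_apply, smul_eq_mul] at h
  exact h.symm

theorem ae_eq_of_integral_schwartz {F G : Plane → ℂ} (hF : LocallyIntegrable F volume)
    (hG : LocallyIntegrable G volume)
    (h : ∀ ρ : 𝓢(Plane, ℂ), HasCompactSupport ρ → ∫ z, ρ z * F z = ∫ z, ρ z * G z) :
    F =ᵐ[volume] G := by
  apply ae_eq_of_integral_contDiff_smul_eq hF hG
  intro g hg hgc
  have hc : HasCompactSupport (fun z => (g z : ℂ)) := hgc.comp_left (g := fun r : ℝ => (r : ℂ)) rfl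
  have hs : ContDiff ℝ (⊤ : ℕ∞) (fun z => (g z : ℂ)) := Complex.ofRealCLM.contDiff.comp hg
  have := h (hc.toSchwartzMap hs) hc
  simpa [Complex.real_smul] using this

theorem locallyIntegrable_L2 (f : L2 ℂ) : LocallyIntegrable f volume :=
  (Lp.memLp f).locallyIntegrable (by norm_num)

theorem locallyIntegrable_continuous_mul {m : Plane → ℂ} (hm : Continuous m) (f : L2 ℂ) :
    LocallyIntegrable (fun z => m z * f z) volume := by
  exact (locallyIntegrable_L2 f).continuous_smul hm

/-- The Fourier transform of `χ ∂_j f`, written without differentiating `f`. -/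
noncomputable def cutDeriv (j : Fin 2) (χ : 𝓢(Plane, ℂ)) (f : L2 ℂ) (ζ : Plane) : ℂ :=
  symbolPartial j ζ * (𝓕 (cut χ f) : L2 ℂ) ζ - (𝓕 (cut (∂_{unitVec j} χ) f) : L2 ℂ) ζ

theorem locallyIntegrable_cutDeriv (j : Fin 2) (χ : 𝓢(Plane, ℂ)) (f : L2 ℂ) :
    LocallyIntegrable (cutDeriv j χ f) volume :=
  (locallyIntegrable_continuous_mul (continuous_symbolPartial j) _).sub (locallyIntegrable_L2 _)

theorem integrable_schwartz_mul_L2 (ρ : 𝓢(Plane, ℂ)) (f : L2 ℂ) :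
    Integrable (fun z => ρ z * f z) volume :=
  (ρ.memLp 2 volume).integrable_mul (Lp.memLp f)

theorem integral_schwartz_mul_eq (f : L2 ℂ) (σ : 𝓢(Plane, ℂ)) :
    ∫ z, σ z * f z = ∫ ζ, (𝓕⁻ σ) ζ * (𝓕 f : L2 ℂ) ζ := by
  rw [integral_fourier_mul_schwartz, FourierTransform.fourier_fourierInv_eq]

theorem integral_mul_fourier_cut (χ : 𝓢(Plane, ℂ)) (f : L2 ℂ) (ρ : 𝓢(Plane, ℂ)) :
    ∫ ζ, ρ ζ * (𝓕 (cut χ f) : L2 ℂ) ζ =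
      ∫ ζ, (𝓕⁻ (SchwartzMap.smulLeftCLM ℂ χ (𝓕 ρ))) ζ * (𝓕 f : L2 ℂ) ζ := by
  rw [integral_fourier_mul_schwartz, ← integral_schwartz_mul_eq]
  apply integral_congr_ae
  filter_upwards [coeFn_cut χ f] with z hz
  rw [hz, SchwartzMap.smulLeftCLM_apply_apply χ.hasTemperateGrowth, smul_eq_mul]
  ring

/-- The product rule in weak form. All operations are moved onto the test function, so `∂_j f` need
not be in `L²`; the right side sees `f` only through the symbol of `∂_j` times its Fourier
transform. -/
theorem integral_mul_cutDeriv (j : Fin 2) (χ : 𝓢(Plane, ℂ)) (f : L2 ℂ) (ρ : 𝓢(Plane, ℂ)) :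
    ∫ ζ, ρ ζ * cutDeriv j χ f ζ =
      ∫ ζ, (𝓕⁻ (SchwartzMap.smulLeftCLM ℂ χ (𝓕 ρ))) ζ * (symbolPartial j ζ * (𝓕 f : L2 ℂ) ζ) := by
  have hg : (fun z : Plane => (inner ℝ z (unitVec j) : ℝ)).HasTemperateGrowth := by fun_prop
  set σ : 𝓢(Plane, ℂ) := SchwartzMap.smulLeftCLM ℂ χ (𝓕 ρ) with hσ
  set ρ' : 𝓢(Plane, ℂ) := (2 * Real.pi * Complex.I) •
    SchwartzMap.smulLeftCLM ℂ (fun z : Plane => (inner ℝ z (unitVec j) : ℝ)) ρ with hρ'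
  have h1 : ∀ ζ, ρ' ζ = symbolPartial j ζ * ρ ζ := by
    intro ζ
    rw [hρ', smul_apply, SchwartzMap.smulLeftCLM_apply_apply hg, inner_unitVec,
      symbolPartial, smul_eq_mul, Complex.real_smul]
    ring
  have h2 : 𝓕 ρ' = - ∂_{unitVec j} (𝓕 ρ) := by
    rw [SchwartzMap.lineDerivOp_fourier_eq, hρ', neg_smul, FourierTransform.fourier_neg, neg_neg]
  have h3 : ∀ ζ, (𝓕⁻ (∂_{unitVec j} σ)) ζ = - (symbolPartial j ζ * (𝓕⁻ σ) ζ) := by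
    intro ζ
    rw [SchwartzMap.fourierInv_lineDerivOp_eq, smul_apply,
      SchwartzMap.smulLeftCLM_apply_apply hg, inner_unitVec, symbolPartial, smul_eq_mul,
      Complex.real_smul]
    ring
  have hσz : ∀ z, σ z = χ z * (𝓕 ρ) z := by
    intro z
    rw [hσ, SchwartzMap.smulLeftCLM_apply_apply χ.hasTemperateGrowth, smul_eq_mul]
  have h4 : ∀ z, (∂_{unitVec j} σ) z = (∂_{unitVec j} χ) z * (𝓕 ρ) z
      + χ z * (∂_{unitVec j} (𝓕 ρ)) z := by
    intro z
    have e : (σ : Plane → ℂ) = fun z => χ z * (𝓕 ρ) z := funext hσz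
    rw [SchwartzMap.lineDerivOp_apply_eq_fderiv, SchwartzMap.lineDerivOp_apply_eq_fderiv,
      SchwartzMap.lineDerivOp_apply_eq_fderiv, e,
      fderiv_fun_mul χ.differentiableAt (𝓕 ρ).differentiableAt]
    simp
    ring
  calc ∫ ζ, ρ ζ * cutDeriv j χ f ζ
      = ∫ ζ, (ρ' ζ * (𝓕 (cut χ f) : L2 ℂ) ζ - ρ ζ * (𝓕 (cut (∂_{unitVec j} χ) f) : L2 ℂ) ζ) := by
        congr 1 with ζ
        rw [h1, cutDeriv]; ring
    _ = ∫ z, ((𝓕 ρ') z * cut χ f z - (𝓕 ρ) z * cut (∂_{unitVec j} χ) f z) := by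
        rw [integral_sub (integrable_schwartz_mul_L2 _ _) (integrable_schwartz_mul_L2 _ _),
          integral_fourier_mul_schwartz, integral_fourier_mul_schwartz,
          ← integral_sub (integrable_schwartz_mul_L2 _ _) (integrable_schwartz_mul_L2 _ _)]
    _ = ∫ z, (- ∂_{unitVec j} σ) z * f z := by
        apply integral_congr_ae
        filter_upwards [coeFn_cut χ f, coeFn_cut (∂_{unitVec j} χ) f] with z hz hz'
        rw [hz, hz', h2, neg_apply, neg_apply, h4]
        ring
    _ = _ := by
        rw [integral_schwartz_mul_eq]
        congr 1 with ζ
        rw [FourierTransform.fourierInv_neg, neg_apply, h3]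
        ring

/-- Used with `∂_y u = ∂_x v`: it trades a cut-off `y`-derivative for a cut-off `x`-derivative,
which the translation factor can compensate. -/
theorem cutDeriv_congr {j k : Fin 2} (χ : 𝓢(Plane, ℂ)) {f g : L2 ℂ}
    (h : (fun ζ => symbolPartial j ζ * (𝓕 f : L2 ℂ) ζ) =ᵐ[volume]
      fun ζ => symbolPartial k ζ * (𝓕 g : L2 ℂ) ζ) :
    cutDeriv j χ f =ᵐ[volume] cutDeriv k χ g := by
  apply ae_eq_of_integral_schwartz (locallyIntegrable_cutDeriv _ _ _)
    (locallyIntegrable_cutDeriv _ _ _)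
  intro ρ _
  rw [integral_mul_cutDeriv, integral_mul_cutDeriv]
  apply integral_congr_ae
  filter_upwards [h] with ζ hζ
  rw [hζ]

theorem cutDeriv_eq_fourier_cut {j : Fin 2} (χ : 𝓢(Plane, ℂ)) {f h : L2 ℂ}
    (hfh : (𝓕 h : L2 ℂ) =ᵐ[volume] fun ζ => symbolPartial j ζ * (𝓕 f : L2 ℂ) ζ) :
    cutDeriv j χ f =ᵐ[volume] (𝓕 (cut χ h) : L2 ℂ) := by
  apply ae_eq_of_integral_schwartz (locallyIntegrable_cutDeriv _ _ _) (locallyIntegrable_L2 _)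
  intro ρ _
  rw [integral_mul_cutDeriv, integral_mul_fourier_cut]
  apply integral_congr_ae
  filter_upwards [hfh] with ζ hζ
  rw [hζ]

theorem cutDeriv_add (j : Fin 2) (χ : 𝓢(Plane, ℂ)) (f g : L2 ℂ) :
    cutDeriv j χ (f + g) =ᵐ[volume] cutDeriv j χ f + cutDeriv j χ g := by
  filter_upwards [Lp.coeFn_add (𝓕 (cut χ f) : L2 ℂ) (𝓕 (cut χ g)),
    Lp.coeFn_add (𝓕 (cut (∂_{unitVec j} χ) f) : L2 ℂ) (𝓕 (cut (∂_{unitVec j} χ) g))] with ζ h1 h2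
  simp only [cutDeriv, cut_add, FourierTransform.fourier_add, Pi.add_apply] at *
  rw [h1, h2]
  ring

/-! ### Translations -/

/-- The Fourier symbol of the translation `f ↦ f(· - a)`. -/
noncomputable def shiftSymbol (a ζ : Plane) : ℂ :=
  Complex.exp (Complex.I * ((-(2 * Real.pi * inner ℝ a ζ) : ℝ) : ℂ))

theorem norm_shiftSymbol (a ζ : Plane) : ‖shiftSymbol a ζ‖ = 1 :=
  Complex.norm_exp_I_mul_ofReal _

theorem contDiff_shiftSymbol (a : Plane) : ContDiff ℝ (⊤ : ℕ∞) (shiftSymbol a) := by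
  unfold shiftSymbol
  apply ContDiff.cexp
  apply contDiff_const.mul
  refine Complex.ofRealCLM.contDiff.comp (ContDiff.neg ?_)
  exact contDiff_const.mul (contDiff_const.inner ℝ contDiff_id)

theorem fourier_shift {a : Plane} {f g : L2 ℂ}
    (h : g =ᵐ[volume] fun z => f (z - a)) :
    (𝓕 g : L2 ℂ) =ᵐ[volume] fun ζ => shiftSymbol a ζ * (𝓕 f : L2 ℂ) ζ := by
  apply ae_eq_of_integral_schwartz (locallyIntegrable_L2 _)
    (locallyIntegrable_continuous_mul (contDiff_shiftSymbol a).continuous _)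
  intro ρ hρ
  -- Compact support makes the product with the smooth phase a Schwartz function, hence an
  -- admissible test function.
  have hc : HasCompactSupport (fun ζ => shiftSymbol a ζ * ρ ζ) := hρ.mul_left
  set ρ' : 𝓢(Plane, ℂ) := hc.toSchwartzMap ((contDiff_shiftSymbol a).mul (ρ.smooth ⊤)) with hρ'
  have h1 : ∀ ζ, ρ' ζ = shiftSymbol a ζ * ρ ζ := fun ζ => rfl
  have h2 : ∀ z, (𝓕 ρ') z = (𝓕 ρ) (z + a) := by
    intro z
    rw [SchwartzMap.fourier_coe, SchwartzMap.fourier_coe, Real.fourier_eq', Real.fourier_eq']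
    congr 1 with ζ
    rw [h1, shiftSymbol, smul_eq_mul, smul_eq_mul, ← mul_assoc, ← Complex.exp_add, inner_add_right,
      real_inner_comm a ζ]
    congr 2
    push_cast
    ring
  have h3 : ∫ ζ, ρ ζ * (shiftSymbol a ζ * (𝓕 f : L2 ℂ) ζ) = ∫ z, (𝓕 ρ) (z + a) * f z := by
    simp_rw [← h2]
    rw [← integral_fourier_mul_schwartz]
    congr 1 with ζ
    rw [h1]; ring
  rw [h3, integral_fourier_mul_schwartz, ← integral_add_right_eq_self _ a]
  apply integral_congr_ae
  have := (measurePreserving_add_right volume a).quasiMeasurePreserving.ae h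
  filter_upwards [this] with z hz
  rw [hz]; simp

/-! ### Interpolation between weighted `L²` spaces -/

theorem enorm_sq_eq_ofReal (z : ℂ) : ‖z‖ₑ ^ 2 = ENNReal.ofReal (‖z‖ ^ 2) := by
  rw [ENNReal.ofReal_pow (norm_nonneg _), ofReal_norm]

theorem enorm_mul_sq (a b : ℂ) : ‖a * b‖ₑ ^ 2 = ‖a‖ₑ ^ 2 * ‖b‖ₑ ^ 2 := by
  rw [enorm_mul, mul_pow]

theorem enorm_add_sq_le (a b : ℂ) : ‖a + b‖ₑ ^ 2 ≤ 2 * ‖a‖ₑ ^ 2 + 2 * ‖b‖ₑ ^ 2 := by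
  simp only [enorm_sq_eq_ofReal]
  rw [show (2 : ℝ≥0∞) = ENNReal.ofReal 2 by simp, ← ENNReal.ofReal_mul (by norm_num),
    ← ENNReal.ofReal_mul (by norm_num), ← ENNReal.ofReal_add (by positivity) (by positivity)]
  apply ENNReal.ofReal_le_ofReal
  have := norm_add_le a b
  nlinarith [norm_nonneg (a + b), sq_nonneg (‖a‖ - ‖b‖)]

theorem lintegral_interpolation_kernel {w : ℝ} (hw : 0 ≤ w) :
    ∫⁻ t in Set.Ioi (0 : ℝ), ENNReal.ofReal (w ^ 2 / (w ^ 2 + t ^ 2)) =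
      ENNReal.ofReal (Real.pi / 2) * ENNReal.ofReal w := by
  rcases hw.eq_or_lt with rfl | hw
  · simp
  have e : ∀ t : ℝ, w ^ 2 / (w ^ 2 + t ^ 2) = (1 + (w⁻¹ * t) ^ 2)⁻¹ := by
    intro t; field_simp
  simp_rw [e]
  have hint : IntegrableOn (fun t : ℝ => (1 + (w⁻¹ * t) ^ 2)⁻¹) (Set.Ioi 0) :=
    (integrable_inv_one_add_sq.comp_mul_left' (inv_ne_zero hw.ne')).integrableOn
  rw [← ofReal_integral_eq_lintegral_ofReal hint
      (Filter.Eventually.of_forall fun t => by positivity),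
    integral_comp_mul_left_Ioi (fun x => (1 + x ^ 2)⁻¹) 0 (inv_pos.2 hw), mul_zero,
    integral_Ioi_inv_one_add_sq, Real.arctan_zero, sub_zero, inv_inv, smul_eq_mul,
    mul_comm, ENNReal.ofReal_mul (by positivity)]

/-- The left side is the minimum of the right over all splittings with the same sum `p + q` (a
quadratic K-functional); the difference is at least a perfect square. -/
theorem interpolation_pointwise_le (w : ℝ) {t : ℝ} (ht : 0 < t) (p q : ℂ) :
    ENNReal.ofReal (w ^ 2 / (w ^ 2 + t ^ 2)) * ‖p + q‖ₑ ^ 2 ≤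
      ENNReal.ofReal (t ^ 2)⁻¹ * (ENNReal.ofReal (w ^ 2) * ‖p‖ₑ ^ 2) + ‖q‖ₑ ^ 2 := by
  simp only [enorm_sq_eq_ofReal]
  rw [← ENNReal.ofReal_mul (by positivity), ← ENNReal.ofReal_mul (by positivity),
    ← ENNReal.ofReal_mul (by positivity), ← ENNReal.ofReal_add (by positivity) (by positivity)]
  apply ENNReal.ofReal_le_ofReal
  have h1 : ‖p + q‖ ^ 2 ≤ (‖p‖ + ‖q‖) ^ 2 := by
    gcongr; exact norm_add_le p q
  generalize ‖p‖ = a at *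
  generalize ‖q‖ = b at *
  have h2 : w ^ 2 * (a + b) ^ 2 ≤ ((t ^ 2)⁻¹ * (w ^ 2 * a ^ 2) + b ^ 2) * (w ^ 2 + t ^ 2) := by
    have h3 : ((t ^ 2)⁻¹ * (w ^ 2 * a ^ 2) + b ^ 2) * (w ^ 2 + t ^ 2) - w ^ 2 * (a + b) ^ 2
        = (w ^ 2 * a / t - t * b) ^ 2 := by
      field_simp; ring
    nlinarith [sq_nonneg (w ^ 2 * a / t - t * b)]
  rw [div_mul_eq_mul_div, div_le_iff₀ (by positivity)]
  exact (mul_le_mul_of_nonneg_left h1 (sq_nonneg w)).trans h2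

/-- The minimizing splitting, where equality holds. -/
theorem interpolation_pointwise_eq (w : ℝ) {t : ℝ} (ht : 0 < t) (v : ℂ) :
    ENNReal.ofReal (t ^ 2)⁻¹ *
        (ENNReal.ofReal (w ^ 2) * ‖((t ^ 2 / (w ^ 2 + t ^ 2) : ℝ) : ℂ) * v‖ₑ ^ 2) +
        ‖((w ^ 2 / (w ^ 2 + t ^ 2) : ℝ) : ℂ) * v‖ₑ ^ 2 =
      ENNReal.ofReal (w ^ 2 / (w ^ 2 + t ^ 2)) * ‖v‖ₑ ^ 2 := by
  simp only [enorm_sq_eq_ofReal]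
  rw [← ENNReal.ofReal_mul (by positivity), ← ENNReal.ofReal_mul (by positivity),
    ← ENNReal.ofReal_mul (by positivity), ← ENNReal.ofReal_add (by positivity) (by positivity)]
  congr 1
  rw [norm_mul, norm_mul, Complex.norm_real, Complex.norm_real, mul_pow, mul_pow, Real.norm_eq_abs,
    Real.norm_eq_abs, sq_abs, sq_abs]
  have : w ^ 2 + t ^ 2 ≠ 0 := by positivity
  field_simp
  ring

theorem lintegral_lintegral_interpolation {γ : Type*} [MeasurableSpace γ] (κ : Measure γ)
    [SFinite κ] {f : γ → ℂ} {v : γ → ℝ} (hf : AEMeasurable f κ) (hv : Measurable v)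
    (hv0 : ∀ x, 0 ≤ v x) :
    ∫⁻ t in Set.Ioi (0 : ℝ), ∫⁻ x, ENNReal.ofReal (v x ^ 2 / (v x ^ 2 + t ^ 2)) *
      ‖f x‖ₑ ^ 2 ∂κ =
    ENNReal.ofReal (Real.pi / 2) * ∫⁻ x, ENNReal.ofReal (v x) * ‖f x‖ₑ ^ 2 ∂κ := by
  have hf2 : AEMeasurable (fun z : ℝ × γ => f z.2) ((volume.restrict (Set.Ioi 0)).prod κ) :=
    hf.comp_quasiMeasurePreserving Measure.quasiMeasurePreserving_snd
  rw [lintegral_lintegral_swap (by fun_prop), ← lintegral_const_mul'' _ (by fun_prop)]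
  congr 1 with x
  rw [lintegral_mul_const _ (by fun_prop), lintegral_interpolation_kernel (hv0 x), mul_assoc]

theorem aemeasurable_lintegral_interpolation {γ : Type*} [MeasurableSpace γ] (κ : Measure γ)
    [SFinite κ] {f : γ → ℂ} {v : γ → ℝ} (hf : AEMeasurable f κ) (hv : Measurable v) :
    AEMeasurable (fun t : ℝ => ∫⁻ x, ENNReal.ofReal (v x ^ 2 / (v x ^ 2 + t ^ 2)) *
      ‖f x‖ₑ ^ 2 ∂κ) (volume.restrict (Set.Ioi 0)) := by
  have hf2 : AEMeasurable (fun z : ℝ × γ => f z.2) ((volume.restrict (Set.Ioi 0)).prod κ) :=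
    hf.comp_quasiMeasurePreserving Measure.quasiMeasurePreserving_snd
  exact AEMeasurable.lintegral_prod_right' (f := fun z : ℝ × γ =>
    ENNReal.ofReal (v z.2 ^ 2 / (v z.2 ^ 2 + z.1 ^ 2)) * ‖f z.2‖ₑ ^ 2) (by fun_prop)

/-- For each `t` the optimal splitting of `V` is compared with an arbitrary splitting of every `G
i`. Integrating over `t > 0` turns `w² / (w² + t²)` into `(π/2) w` on both sides, so the endpoint
weights `w²` and `1` give the weight `w` with the same constant `C`. -/
theorem tsum_lintegral_interpolation {ι α β : Type*} [Countable ι] [MeasurableSpace α]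
    [MeasurableSpace β] {μ : Measure α} {ν : Measure β} [SFinite μ] [SFinite ν]
    {V : α → ℂ} {G : ι → β → ℂ} {w : α → ℝ} {w' : β → ℝ} {C : ℝ≥0∞}
    (hV : AEMeasurable V μ) (hG : ∀ i, AEMeasurable (G i) ν)
    (hw : Measurable w) (hw0 : ∀ x, 0 ≤ w x) (hw' : Measurable w') (hw0' : ∀ x, 0 ≤ w' x)
    (H : ∀ t : ℝ, 0 < t → ∃ P Q : ι → β → ℂ,
      (∀ i, AEMeasurable (P i) ν) ∧ (∀ i, AEMeasurable (Q i) ν) ∧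
      (∀ i, G i =ᵐ[ν] P i + Q i) ∧
      ∑' i, ∫⁻ x, ENNReal.ofReal (w' x ^ 2) * ‖P i x‖ₑ ^ 2 ∂ν ≤
        C * ∫⁻ x, ENNReal.ofReal (w x ^ 2) *
          ‖((t ^ 2 / (w x ^ 2 + t ^ 2) : ℝ) : ℂ) * V x‖ₑ ^ 2 ∂μ ∧
      ∑' i, ∫⁻ x, ‖Q i x‖ₑ ^ 2 ∂ν ≤
        C * ∫⁻ x, ‖((w x ^ 2 / (w x ^ 2 + t ^ 2) : ℝ) : ℂ) * V x‖ₑ ^ 2 ∂μ) :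
    ∑' i, ∫⁻ x, ENNReal.ofReal (w' x) * ‖G i x‖ₑ ^ 2 ∂ν ≤
      C * ∫⁻ x, ENNReal.ofReal (w x) * ‖V x‖ₑ ^ 2 ∂μ := by
  have key : ∀ t : ℝ, 0 < t →
      ∑' i, ∫⁻ x, ENNReal.ofReal (w' x ^ 2 / (w' x ^ 2 + t ^ 2)) * ‖G i x‖ₑ ^ 2 ∂ν ≤
        C * ∫⁻ x, ENNReal.ofReal (w x ^ 2 / (w x ^ 2 + t ^ 2)) * ‖V x‖ₑ ^ 2 ∂μ := by
    intro t ht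
    obtain ⟨P, Q, hP, hQ, hPQ, h1, h2⟩ := H t ht
    calc _ ≤ ∑' i, (ENNReal.ofReal (t ^ 2)⁻¹ * ∫⁻ x, ENNReal.ofReal (w' x ^ 2) * ‖P i x‖ₑ ^ 2 ∂ν
            + ∫⁻ x, ‖Q i x‖ₑ ^ 2 ∂ν) := by
          refine ENNReal.tsum_le_tsum fun i => ?_
          have hm : AEMeasurable (fun x => ENNReal.ofReal (w' x ^ 2) * ‖P i x‖ₑ ^ 2) ν := by
            have := hP i
            fun_prop
          rw [← lintegral_const_mul'' _ hm, ← lintegral_add_left' (hm.const_mul _)]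
          apply lintegral_mono_ae
          filter_upwards [hPQ i] with x hx
          rw [hx]
          exact interpolation_pointwise_le _ ht _ _
      _ = ENNReal.ofReal (t ^ 2)⁻¹ * ∑' i, ∫⁻ x, ENNReal.ofReal (w' x ^ 2) * ‖P i x‖ₑ ^ 2 ∂ν
            + ∑' i, ∫⁻ x, ‖Q i x‖ₑ ^ 2 ∂ν := by
          rw [ENNReal.tsum_add, ENNReal.tsum_mul_left]
      _ ≤ ENNReal.ofReal (t ^ 2)⁻¹ * (C * ∫⁻ x, ENNReal.ofReal (w x ^ 2) *
            ‖((t ^ 2 / (w x ^ 2 + t ^ 2) : ℝ) : ℂ) * V x‖ₑ ^ 2 ∂μ) +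
            C * ∫⁻ x, ‖((w x ^ 2 / (w x ^ 2 + t ^ 2) : ℝ) : ℂ) * V x‖ₑ ^ 2 ∂μ := by
          gcongr
      _ = _ := by
          have hm : AEMeasurable (fun x => ENNReal.ofReal (w x ^ 2) *
              ‖((t ^ 2 / (w x ^ 2 + t ^ 2) : ℝ) : ℂ) * V x‖ₑ ^ 2) μ := by fun_prop
          rw [mul_left_comm, ← mul_add, ← lintegral_const_mul'' _ hm,
            ← lintegral_add_left' (hm.const_mul _)]
          simp_rw [interpolation_pointwise_eq _ ht]
  have hpi0 : ENNReal.ofReal (Real.pi / 2) ≠ 0 := by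
    simp [Real.pi_pos]
  have fin : ENNReal.ofReal (Real.pi / 2) *
      ∑' i, ∫⁻ x, ENNReal.ofReal (w' x) * ‖G i x‖ₑ ^ 2 ∂ν ≤
      ENNReal.ofReal (Real.pi / 2) * (C * ∫⁻ x, ENNReal.ofReal (w x) * ‖V x‖ₑ ^ 2 ∂μ) := by
    rw [mul_left_comm, ← lintegral_lintegral_interpolation μ hV hw hw0, ← ENNReal.tsum_mul_left]
    have e : ∀ i, _ := fun i => (lintegral_lintegral_interpolation ν (hG i) hw' hw0').symm
    simp_rw [e]
    rw [← lintegral_tsum (fun i => aemeasurable_lintegral_interpolation ν (hG i) hw'),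
      ← lintegral_const_mul'' _ (aemeasurable_lintegral_interpolation μ hV hw)]
    exact setLIntegral_mono' measurableSet_Ioi fun t ht => key t ht
  exact (ENNReal.mul_le_mul_iff_right hpi0 ENNReal.ofReal_ne_top).1 fin

/-! ### Plancherel, overlap sums and the symbols -/

theorem lintegral_enorm_sq {μ : Measure Plane} {𝕜 : Type*} [RCLike 𝕜]
    (f : Lp (α := Plane) 𝕜 2 μ) : ∫⁻ z, ‖f z‖ₑ ^ 2 ∂μ = ENNReal.ofReal (‖f‖ ^ 2) := by
  rw [ENNReal.ofReal_pow (norm_nonneg _), ofReal_norm, Lp.enorm_def,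
    eLpNorm_eq_lintegral_rpow_enorm_toReal (by norm_num) (by norm_num)]
  simp only [ENNReal.toReal_ofNat, ENNReal.rpow_ofNat]
  rw [← ENNReal.rpow_natCast, ← ENNReal.rpow_mul]
  norm_num

theorem lintegral_enorm_sq_fourier (f : L2 ℂ) :
    ∫⁻ ζ, ‖(𝓕 f : L2 ℂ) ζ‖ₑ ^ 2 = ∫⁻ z, ‖f z‖ₑ ^ 2 := by
  rw [lintegral_enorm_sq, lintegral_enorm_sq, Lp.norm_fourier_eq]

theorem aemeasurable_L2 (f : L2 ℂ) : AEMeasurable f volume :=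
  (Lp.aestronglyMeasurable f).aemeasurable

theorem aemeasurable_cutDeriv (j : Fin 2) (χ : 𝓢(Plane, ℂ)) (f : L2 ℂ) :
    AEMeasurable (cutDeriv j χ f) volume :=
  ((continuous_symbolPartial j).aemeasurable.mul (aemeasurable_L2 _)).sub (aemeasurable_L2 _)

/-- Plancherel returns to physical space, where the overlap bound applies pointwise. -/
theorem tsum_lintegral_fourier_cut_le {χ : ℕ → 𝓢(Plane, ℂ)} {K : ℝ≥0∞}
    (hχ : ∀ z, ∑' i, ‖χ i z‖ₑ ^ 2 ≤ K) (f : L2 ℂ) :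
    ∑' i, ∫⁻ ζ, ‖(𝓕 (cut (χ i) f) : L2 ℂ) ζ‖ₑ ^ 2 ≤ K * ∫⁻ ζ, ‖(𝓕 f : L2 ℂ) ζ‖ₑ ^ 2 := by
  have hf := aemeasurable_L2 f
  have hm : ∀ i, Measurable (χ i) := fun i => (χ i).continuous.measurable
  have e : ∀ i, ∫⁻ ζ, ‖(𝓕 (cut (χ i) f) : L2 ℂ) ζ‖ₑ ^ 2 =
      ∫⁻ z, ‖χ i z‖ₑ ^ 2 * ‖f z‖ₑ ^ 2 := by
    intro i
    rw [lintegral_enorm_sq_fourier]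
    apply lintegral_congr_ae
    filter_upwards [coeFn_cut (χ i) f] with z hz
    rw [hz, enorm_mul_sq]
  simp_rw [e]
  rw [lintegral_enorm_sq_fourier, ← lintegral_tsum (fun i => by have := hm i; fun_prop),
    ← lintegral_const_mul'' _ (by fun_prop)]
  apply lintegral_mono
  intro z
  simp only
  rw [ENNReal.tsum_mul_right]
  gcongr
  exact hχ z

theorem exists_fourier_eq {m : Plane → ℂ} {f : L2 ℂ}
    (h : MemLp (fun ζ => m ζ * (𝓕 f : L2 ℂ) ζ) 2 volume) :
    ∃ g : L2 ℂ, (𝓕 g : L2 ℂ) =ᵐ[volume] fun ζ => m ζ * (𝓕 f : L2 ℂ) ζ := by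
  refine ⟨𝓕⁻ (h.toLp _), ?_⟩
  rw [FourierTransform.fourier_fourierInv_eq]
  exact h.coeFn_toLp

theorem ae_apply_zero_ne_zero : ∀ᵐ ζ : Plane, ζ 0 ≠ 0 := by
  have h : volume ((EuclideanSpace.proj 0 : Plane →L[ℝ] ℝ).ker : Set Plane) = 0 := by
    apply Measure.addHaar_submodule
    intro htop
    have : unitVec 0 ∈ (EuclideanSpace.proj 0 : Plane →L[ℝ] ℝ).ker := by
      rw [htop]; trivial
    simp [unitVec] at this
  filter_upwards [measure_eq_zero_iff_ae_notMem.1 h] with ζ hζ h0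
  exact hζ (by simpa using h0)

/-- The modulus `2π|ξ|` of the symbol of `∂_x`. -/
noncomputable def absX (ζ : Plane) : ℝ := 2 * Real.pi * |ζ 0|

theorem absX_nonneg (ζ : Plane) : 0 ≤ absX ζ := by unfold absX; positivity

theorem measurable_absX : Measurable absX := by unfold absX; fun_prop

theorem norm_symbolPartial_zero (ζ : Plane) : ‖symbolPartial 0 ζ‖ = absX ζ := by
  simp [symbolPartial, absX, Real.pi_pos.le]

theorem enorm_symbolPartial_zero_sq (ζ : Plane) :
    ‖symbolPartial 0 ζ‖ₑ ^ 2 = ENNReal.ofReal (absX ζ ^ 2) := by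
  rw [enorm_sq_eq_ofReal, norm_symbolPartial_zero]

theorem enorm_symbolDx_sq (s : ℝ) (ζ : Plane) :
    ‖symbolDx s ζ‖ₑ ^ 2 = ENNReal.ofReal (absX ζ ^ (2 * s)) := by
  have h := absX_nonneg ζ
  rw [enorm_sq_eq_ofReal, symbolDx, Complex.norm_real, Real.norm_eq_abs, sq_abs,
    ← Real.rpow_natCast, ← absX, ← Real.rpow_mul h]
  congr 2
  push_cast; ring

theorem enorm_symbolA_sq (ζ : Plane) : ‖symbolA ζ‖ₑ ^ 2 = ENNReal.ofReal (absX ζ) := by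
  rw [symbolA, enorm_symbolDx_sq]; norm_num

theorem enorm_symbolB_sq (ζ : Plane) :
    ‖symbolB ζ‖ₑ ^ 2 = ENNReal.ofReal (absX ζ)⁻¹ * ‖symbolPartial 1 ζ‖ₑ ^ 2 := by
  rw [symbolB, enorm_mul_sq, enorm_symbolDx_sq]
  congr 2
  rw [show (2 * (-(1 / 2)) : ℝ) = -1 by norm_num, Real.rpow_neg_one]

theorem enorm_symbolC_sq (ζ : Plane) :
    ‖symbolC ζ‖ₑ ^ 2 = ENNReal.ofReal ((absX ζ)⁻¹ ^ 2) * ‖symbolPartial 1 ζ‖ₑ ^ 2 := by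
  rw [symbolC, enorm_mul_sq, enorm_sq_eq_ofReal, norm_inv]
  congr 4
  exact norm_symbolPartial_zero ζ

theorem memLp_mul_fourier_of_norm_le {m : Plane → ℂ} (hm : Measurable m) {c : ℝ}
    (hc : ∀ ζ, ‖m ζ‖ ≤ c) (f : L2 ℂ) : MemLp (fun ζ => m ζ * (𝓕 f : L2 ℂ) ζ) 2 volume := by
  refine (Lp.memLp (𝓕 f : L2 ℂ)).of_le_mul (c := c)
    (hm.aemeasurable.mul (aemeasurable_L2 _)).aestronglyMeasurable
    (Filter.Eventually.of_forall fun ζ => ?_)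
  rw [norm_mul]
  gcongr
  exact hc ζ

theorem exists_fourier_decomposition {p q : Plane → ℝ} (hp : Measurable p) (hq : Measurable q)
    (hp0 : ∀ ζ, 0 ≤ p ζ) (hq0 : ∀ ζ, 0 ≤ q ζ) (hpq : ∀ ζ, p ζ + q ζ = 1) (u : L2 ℂ) :
    ∃ a b : L2 ℂ, u = a + b ∧ ((𝓕 a : L2 ℂ) =ᵐ[volume] fun ζ => (p ζ : ℂ) * (𝓕 u : L2 ℂ) ζ) ∧
      ((𝓕 b : L2 ℂ) =ᵐ[volume] fun ζ => (q ζ : ℂ) * (𝓕 u : L2 ℂ) ζ) := by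
  have hpc : Measurable fun ζ => (p ζ : ℂ) := by fun_prop
  have hqc : Measurable fun ζ => (q ζ : ℂ) := by fun_prop
  obtain ⟨a, ha⟩ := exists_fourier_eq (memLp_mul_fourier_of_norm_le hpc (c := 1) (fun ζ => by
    rw [Complex.norm_real, Real.norm_of_nonneg (hp0 ζ)]; linarith [hq0 ζ, hpq ζ]) u)
  obtain ⟨b, hb⟩ := exists_fourier_eq (memLp_mul_fourier_of_norm_le hqc (c := 1) (fun ζ => by
    rw [Complex.norm_real, Real.norm_of_nonneg (hq0 ζ)]; linarith [hp0 ζ, hpq ζ]) u)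
  refine ⟨a, b, ?_, ha, hb⟩
  apply (Lp.fourierTransformₗᵢ Plane ℂ).injective
  change (𝓕 u : L2 ℂ) = 𝓕 (a + b)
  rw [FourierTransform.fourier_add]
  apply Lp.ext
  filter_upwards [ha, hb, Lp.coeFn_add (𝓕 a : L2 ℂ) (𝓕 b)] with ζ h1 h2 h3
  rw [h3, Pi.add_apply, h1, h2, ← add_mul, ← Complex.ofReal_add, hpq, Complex.ofReal_one, one_mul]

/-! ### Summed estimates for a family of cutoffs -/

section Family

variable {χ : ℕ → 𝓢(Plane, ℂ)} {K : ℝ≥0∞}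

/-- The order-one endpoint: `∂_x(χ f) = χ ∂_x f + (∂_x χ) f`. -/
theorem tsum_lintegral_absX_sq_fourier_cut_le (hχ : ∀ z, ∑' i, ‖χ i z‖ₑ ^ 2 ≤ K)
    (hχ' : ∀ j z, ∑' i, ‖(∂_{unitVec j} (χ i)) z‖ₑ ^ 2 ≤ K) {f : L2 ℂ}
    (hf : MemLp (fun ζ => symbolPartial 0 ζ * (𝓕 f : L2 ℂ) ζ) 2 volume) :
    ∑' i, ∫⁻ ζ, ENNReal.ofReal (absX ζ ^ 2) * ‖(𝓕 (cut (χ i) f) : L2 ℂ) ζ‖ₑ ^ 2 ≤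
      2 * K * ∫⁻ ζ, ENNReal.ofReal (1 + absX ζ ^ 2) * ‖(𝓕 f : L2 ℂ) ζ‖ₑ ^ 2 := by
  obtain ⟨h, hh⟩ := exists_fourier_eq hf
  have hF := aemeasurable_L2 (𝓕 f : L2 ℂ)
  calc _ ≤ ∑' i, (2 * (∫⁻ ζ, ‖(𝓕 (cut (χ i) h) : L2 ℂ) ζ‖ₑ ^ 2) +
        2 * ∫⁻ ζ, ‖(𝓕 (cut (∂_{unitVec 0} (χ i)) f) : L2 ℂ) ζ‖ₑ ^ 2) := by
        refine ENNReal.tsum_le_tsum fun i => ?_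
        have h1 := aemeasurable_L2 (𝓕 (cut (χ i) h) : L2 ℂ)
        have h2 := aemeasurable_L2 (𝓕 (cut (∂_{unitVec 0} (χ i)) f) : L2 ℂ)
        rw [← lintegral_const_mul'' _ (by fun_prop), ← lintegral_const_mul'' _ (by fun_prop),
          ← lintegral_add_left' (by fun_prop)]
        apply lintegral_mono_ae
        filter_upwards [cutDeriv_eq_fourier_cut (χ i) hh] with ζ hζ
        rw [← enorm_symbolPartial_zero_sq, ← enorm_mul_sq, ← hζ,
          show symbolPartial 0 ζ * (𝓕 (cut (χ i) f) : L2 ℂ) ζ = cutDeriv 0 (χ i) f ζ +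
            (𝓕 (cut (∂_{unitVec 0} (χ i)) f) : L2 ℂ) ζ by simp [cutDeriv]]
        exact enorm_add_sq_le _ _
    _ ≤ 2 * (K * ∫⁻ ζ, ‖(𝓕 h : L2 ℂ) ζ‖ₑ ^ 2) + 2 * (K * ∫⁻ ζ, ‖(𝓕 f : L2 ℂ) ζ‖ₑ ^ 2) := by
        rw [ENNReal.tsum_add, ENNReal.tsum_mul_left, ENNReal.tsum_mul_left]
        gcongr
        · exact tsum_lintegral_fourier_cut_le hχ h
        · exact tsum_lintegral_fourier_cut_le (hχ' 0) f
    _ = _ := by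
        have e : ∫⁻ ζ, ‖(𝓕 h : L2 ℂ) ζ‖ₑ ^ 2 =
            ∫⁻ ζ, ENNReal.ofReal (absX ζ ^ 2) * ‖(𝓕 f : L2 ℂ) ζ‖ₑ ^ 2 := by
          apply lintegral_congr_ae
          filter_upwards [hh] with ζ hζ
          rw [hζ, enorm_mul_sq, enorm_symbolPartial_zero_sq]
        have e2 : ∀ ζ, ENNReal.ofReal (1 + absX ζ ^ 2) = 1 + ENNReal.ofReal (absX ζ ^ 2) := by
          intro ζ
          rw [ENNReal.ofReal_add zero_le_one (sq_nonneg _), ENNReal.ofReal_one]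
        simp_rw [e, e2, add_mul, one_mul]
        rw [lintegral_add_left' (by fun_prop)]
        ring

/-- Interpolation between order 0 and order 1 in `x`. The source weight is inhomogeneous because the
term `(∂_x χ) f` costs a full `L²` norm. -/
theorem tsum_lintegral_absX_fourier_cut_le (hχ : ∀ z, ∑' i, ‖χ i z‖ₑ ^ 2 ≤ K)
    (hχ' : ∀ j z, ∑' i, ‖(∂_{unitVec j} (χ i)) z‖ₑ ^ 2 ≤ K) (u : L2 ℂ) :
    ∑' i, ∫⁻ ζ, ENNReal.ofReal (absX ζ) * ‖(𝓕 (cut (χ i) u) : L2 ℂ) ζ‖ₑ ^ 2 ≤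
      2 * K * ∫⁻ ζ, ENNReal.ofReal √(1 + absX ζ ^ 2) * ‖(𝓕 u : L2 ℂ) ζ‖ₑ ^ 2 := by
  have hX := measurable_absX
  apply tsum_lintegral_interpolation (aemeasurable_L2 _) (fun i => aemeasurable_L2 _)
    (by fun_prop) (fun ζ => Real.sqrt_nonneg _) measurable_absX absX_nonneg
  intro t ht
  have hw : ∀ ζ, √(1 + absX ζ ^ 2) ^ 2 = 1 + absX ζ ^ 2 := fun ζ =>
    Real.sq_sqrt (by positivity)
  simp_rw [hw]
  obtain ⟨a, b, hab, ha, hb⟩ := exists_fourier_decomposition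
    (p := fun ζ => t ^ 2 / (1 + absX ζ ^ 2 + t ^ 2))
    (q := fun ζ => (1 + absX ζ ^ 2) / (1 + absX ζ ^ 2 + t ^ 2)) (by fun_prop) (by fun_prop)
    (fun ζ => by positivity) (fun ζ => by positivity) (fun ζ => by field_simp; ring) u
  have hma : MemLp (fun ζ => symbolPartial 0 ζ * (𝓕 a : L2 ℂ) ζ) 2 volume := by
    have hs := (continuous_symbolPartial 0).measurable
    have := memLp_mul_fourier_of_norm_le (c := t ^ 2)
      (m := fun ζ => symbolPartial 0 ζ * ((t ^ 2 / (1 + absX ζ ^ 2 + t ^ 2) : ℝ) : ℂ))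
      (by fun_prop) (fun ζ => by
        have := absX_nonneg ζ
        rw [norm_mul, norm_symbolPartial_zero, Complex.norm_real,
          Real.norm_of_nonneg (by positivity), ← mul_div_assoc, div_le_iff₀ (by positivity)]
        nlinarith [sq_nonneg (absX ζ - 1), sq_nonneg t,
          mul_nonneg (sq_nonneg t) (sq_nonneg (absX ζ - 1)),
          mul_nonneg (sq_nonneg t) (sq_nonneg (absX ζ)),
          mul_nonneg (sq_nonneg t) (sq_nonneg t)]) u
    refine (memLp_congr_ae ?_).1 this
    filter_upwards [ha] with ζ hζ
    rw [hζ, mul_assoc]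
  refine ⟨fun i => (𝓕 (cut (χ i) a) : L2 ℂ), fun i => (𝓕 (cut (χ i) b) : L2 ℂ),
    fun i => aemeasurable_L2 _, fun i => aemeasurable_L2 _, fun i => ?_, ?_, ?_⟩
  · rw [hab, cut_add, FourierTransform.fourier_add]
    exact Lp.coeFn_add _ _
  · refine (tsum_lintegral_absX_sq_fourier_cut_le hχ hχ' hma).trans_eq ?_
    congr 1
    apply lintegral_congr_ae
    filter_upwards [ha] with ζ hζ
    rw [hζ]
  · refine (tsum_lintegral_fourier_cut_le hχ b).trans ?_
    refine mul_le_mul' (le_mul_of_one_le_left' (by norm_num)) (lintegral_mono_ae ?_)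
    filter_upwards [hb] with ζ hζ
    rw [hζ]

/-- The horizontal vector of length `L`. -/
noncomputable def shiftVec (L : ℝ) : Plane := L • unitVec 0

/-- The modulus of the symbol of `f ↦ f - f(· - (L, 0))`. -/
noncomputable def absShift (L : ℝ) (ζ : Plane) : ℝ := ‖1 - shiftSymbol (shiftVec L) ζ‖

theorem absShift_nonneg (L : ℝ) (ζ : Plane) : 0 ≤ absShift L ζ := norm_nonneg _

theorem measurable_absShift (L : ℝ) : Measurable (absShift L) :=
  (continuous_const.sub (contDiff_shiftSymbol _).continuous).norm.measurable

theorem absShift_le_two (L : ℝ) (ζ : Plane) : absShift L ζ ≤ 2 := by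
  refine (norm_sub_le _ _).trans ?_
  rw [norm_shiftSymbol, norm_one]; norm_num

theorem absShift_le_mul {L : ℝ} (hL : 0 ≤ L) (ζ : Plane) : absShift L ζ ≤ L * absX ζ := by
  rw [absShift, norm_sub_rev]
  refine Real.norm_exp_I_mul_ofReal_sub_one_le.trans_eq ?_
  rw [norm_neg, shiftVec, inner_smul_left, real_inner_comm, inner_unitVec, absX]
  simp only [norm_mul, Real.norm_eq_abs, conj_trivial, abs_of_nonneg hL,
    abs_of_pos Real.pi_pos, Nat.abs_ofNat]
  ring

theorem absShift_div_le {L : ℝ} (hL : 0 ≤ L) (ζ : Plane) : absShift L ζ / absX ζ ≤ L :=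
  div_le_of_le_mul₀ (absX_nonneg ζ) hL (absShift_le_mul hL ζ)

theorem absShift_div_nonneg (L : ℝ) (ζ : Plane) : 0 ≤ absShift L ζ / absX ζ :=
  div_nonneg (absShift_nonneg L ζ) (absX_nonneg ζ)

theorem absShift_div_mul_le (L : ℝ) (ζ : Plane) :
    absShift L ζ / absX ζ * absX ζ ≤ 2 := by
  rcases eq_or_ne (absX ζ) 0 with h | h
  · simp [h]
  · rw [div_mul_cancel₀ _ h]; exact absShift_le_two L ζ

/-- Since `χ ∂_y u = ∂_x(χ v) - (∂_x χ) v`, the weight `r = absShift / absX` meets either a factor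
`absX`, with `r * absX ≤ 2`, or none, with `r ≤ L`. -/
theorem tsum_lintegral_absShift_div_sq_cutDeriv_le (hχ : ∀ z, ∑' i, ‖χ i z‖ₑ ^ 2 ≤ K)
    (hχ' : ∀ j z, ∑' i, ‖(∂_{unitVec j} (χ i)) z‖ₑ ^ 2 ≤ K) {L : ℝ} (hL : 0 ≤ L) {u v : L2 ℂ}
    (huv : (fun ζ => symbolPartial 1 ζ * (𝓕 u : L2 ℂ) ζ) =ᵐ[volume]
      fun ζ => symbolPartial 0 ζ * (𝓕 v : L2 ℂ) ζ) :
    ∑' i, ∫⁻ ζ, ENNReal.ofReal ((absShift L ζ / absX ζ) ^ 2) * ‖cutDeriv 1 (χ i) u ζ‖ₑ ^ 2 ≤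
      4 * ENNReal.ofReal (4 + L ^ 2) * K * ∫⁻ ζ, ‖(𝓕 v : L2 ℂ) ζ‖ₑ ^ 2 := by
  calc _ ≤ ∑' i, (2 * ENNReal.ofReal (4 + L ^ 2) * (∫⁻ ζ, ‖(𝓕 (cut (χ i) v) : L2 ℂ) ζ‖ₑ ^ 2) +
        2 * ENNReal.ofReal (4 + L ^ 2) *
          ∫⁻ ζ, ‖(𝓕 (cut (∂_{unitVec 0} (χ i)) v) : L2 ℂ) ζ‖ₑ ^ 2) := by
        refine ENNReal.tsum_le_tsum fun i => ?_
        have h1 := aemeasurable_L2 (𝓕 (cut (χ i) v) : L2 ℂ)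
        have h2 := aemeasurable_L2 (𝓕 (cut (∂_{unitVec 0} (χ i)) v) : L2 ℂ)
        rw [← lintegral_const_mul'' _ (by fun_prop), ← lintegral_const_mul'' _ (by fun_prop),
          ← lintegral_add_left' (by fun_prop)]
        apply lintegral_mono_ae
        filter_upwards [cutDeriv_congr (χ i) huv] with ζ hζ
        rw [hζ, cutDeriv, sub_eq_add_neg]
        have hA := absShift_div_mul_le L ζ
        have hB := absShift_div_le hL ζ
        have h0 := absShift_div_nonneg L ζ
        have hX := absX_nonneg ζ
        -- Only `r * absX ≤ 2` and `0 ≤ r ≤ L` matter now; both squares are at most `4 + L ^ 2`.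
        generalize absShift L ζ / absX ζ = r at *
        refine (mul_le_mul_right (enorm_add_sq_le _ _) _).trans ?_
        rw [enorm_neg, enorm_mul_sq, enorm_symbolPartial_zero_sq, mul_add]
        refine add_le_add ?_ ?_
        · rw [mul_left_comm, ← mul_assoc (ENNReal.ofReal _), ← ENNReal.ofReal_mul (sq_nonneg r),
            mul_assoc]
          gcongr
          nlinarith [mul_nonneg h0 hX]
        · rw [mul_left_comm, mul_assoc]
          gcongr
          nlinarith
    _ ≤ 2 * ENNReal.ofReal (4 + L ^ 2) * (K * ∫⁻ ζ, ‖(𝓕 v : L2 ℂ) ζ‖ₑ ^ 2) +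
        2 * ENNReal.ofReal (4 + L ^ 2) * (K * ∫⁻ ζ, ‖(𝓕 v : L2 ℂ) ζ‖ₑ ^ 2) := by
        rw [ENNReal.tsum_add, ENNReal.tsum_mul_left, ENNReal.tsum_mul_left]
        gcongr
        · exact tsum_lintegral_fourier_cut_le hχ v
        · exact tsum_lintegral_fourier_cut_le (hχ' 0) v
    _ = _ := by ring

theorem norm_symbolB_sq (ζ : Plane) :
    ‖symbolB ζ‖ ^ 2 = (absX ζ)⁻¹ * ‖symbolPartial 1 ζ‖ ^ 2 := by
  have h := enorm_symbolB_sq ζ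
  have := absX_nonneg ζ
  rw [enorm_sq_eq_ofReal, enorm_sq_eq_ofReal, ← ENNReal.ofReal_mul (by positivity)] at h
  exact (ENNReal.ofReal_eq_ofReal_iff (by positivity) (by positivity)).1 h

/-- With its companion below, this shows that both pieces of the optimal splitting land in their
endpoint spaces when only the half-order norm is finite. Both rest on `2wt ≤ w² + t²`. -/
theorem interpolation_weight_sq_le {w t : ℝ} (hw : 0 ≤ w) (ht : 0 < t) :
    (w ^ 2 / (w ^ 2 + t ^ 2)) ^ 2 ≤ (2 * t)⁻¹ * w := by
  have h1 : 0 ≤ w ^ 2 / (w ^ 2 + t ^ 2) := by positivity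
  have h2 : w ^ 2 / (w ^ 2 + t ^ 2) ≤ 1 := by
    rw [div_le_one (by positivity)]; nlinarith [sq_nonneg t]
  have h3 : w ^ 2 / (w ^ 2 + t ^ 2) ≤ (2 * t)⁻¹ * w := by
    rw [div_le_iff₀ (by positivity), inv_mul_eq_div, div_mul_eq_mul_div, le_div_iff₀ (by positivity)]
    nlinarith [mul_nonneg hw (sq_nonneg (w - t))]
  nlinarith

theorem interpolation_weight_mul_sq_le {w t : ℝ} (hw : 0 ≤ w) (ht : 0 < t) :
    (w * (t ^ 2 / (w ^ 2 + t ^ 2))) ^ 2 ≤ t / 2 * w := by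
  have h1 : 0 ≤ t ^ 2 / (w ^ 2 + t ^ 2) := by positivity
  have h2 : t ^ 2 / (w ^ 2 + t ^ 2) ≤ 1 := by
    rw [div_le_one (by positivity)]; nlinarith [sq_nonneg w]
  have h3 : w * (t ^ 2 / (w ^ 2 + t ^ 2)) ≤ t / 2 := by
    rw [← mul_div_assoc, div_le_iff₀ (by positivity)]
    nlinarith [mul_nonneg ht.le (sq_nonneg (w - t))]
  have h4 : w * (t ^ 2 / (w ^ 2 + t ^ 2)) ≤ w := mul_le_of_le_one_right hw h2
  have h5 : 0 ≤ w * (t ^ 2 / (w ^ 2 + t ^ 2)) := by positivity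
  nlinarith

theorem memLp_mul_of_norm_sq_le_symbolB {u : L2 ℂ} {m : Plane → ℂ} (hm : Measurable m) {c : ℝ}
    (hc : 0 ≤ c) (h : ∀ ζ, ‖m ζ‖ ^ 2 ≤ c * ‖symbolB ζ‖ ^ 2)
    (hu : MemLp (fun ζ => symbolB ζ * (𝓕 u : L2 ℂ) ζ) 2 volume) :
    MemLp (fun ζ => m ζ * (𝓕 u : L2 ℂ) ζ) 2 volume := by
  refine hu.of_le_mul (c := √c) (hm.aemeasurable.mul (aemeasurable_L2 _)).aestronglyMeasurable
    (Filter.Eventually.of_forall fun ζ => ?_)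
  rw [norm_mul, norm_mul, ← mul_assoc]
  gcongr
  apply le_of_sq_le_sq _ (by positivity)
  rw [mul_pow, Real.sq_sqrt hc]
  exact h ζ

/-- Interpolation with `w = 1/|2πξ|` for `∂_y u = ∂_y a + ∂_y b`: the part `a` has `∂_x^{-1} ∂_y a`
in `L²` and uses the previous summed estimate, while `∂_y b` is in `L²` and uses only the overlap
bound. -/
theorem tsum_lintegral_absShift_div_cutDeriv_le (hχ : ∀ z, ∑' i, ‖χ i z‖ₑ ^ 2 ≤ K)
    (hχ' : ∀ j z, ∑' i, ‖(∂_{unitVec j} (χ i)) z‖ₑ ^ 2 ≤ K) {L : ℝ} (hL : 0 ≤ L) {u : L2 ℂ}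
    (hu : MemLp (fun ζ => symbolB ζ * (𝓕 u : L2 ℂ) ζ) 2 volume) :
    ∑' i, ∫⁻ ζ, ENNReal.ofReal (absShift L ζ / absX ζ) * ‖cutDeriv 1 (χ i) u ζ‖ₑ ^ 2 ≤
      4 * ENNReal.ofReal (4 + L ^ 2) * K *
        ∫⁻ ζ, ENNReal.ofReal (absX ζ)⁻¹ * ‖symbolPartial 1 ζ * (𝓕 u : L2 ℂ) ζ‖ₑ ^ 2 := by
  have hX := measurable_absX
  have hs0 := (continuous_symbolPartial 0).measurable
  have hs1 := (continuous_symbolPartial 1).measurable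
  apply tsum_lintegral_interpolation (hs1.aemeasurable.mul (aemeasurable_L2 _))
    (fun i => aemeasurable_cutDeriv _ _ _) (by fun_prop)
    (fun ζ => inv_nonneg.2 (absX_nonneg ζ)) ((measurable_absShift L).div hX)
    (absShift_div_nonneg L)
  intro t ht
  obtain ⟨a, b, hab, ha, hb⟩ := exists_fourier_decomposition
    (p := fun ζ => t ^ 2 / ((absX ζ)⁻¹ ^ 2 + t ^ 2))
    (q := fun ζ => (absX ζ)⁻¹ ^ 2 / ((absX ζ)⁻¹ ^ 2 + t ^ 2)) (by fun_prop) (by fun_prop)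
    (fun ζ => by positivity) (fun ζ => by positivity)
    (fun ζ => by rw [← add_div, add_comm, div_self (by positivity)]) u
  -- Here `v = ∂_x^{-1} ∂_y a` and, below, `h = ∂_y b`.
  obtain ⟨v, hv⟩ := exists_fourier_eq (memLp_mul_of_norm_sq_le_symbolB
    (m := fun ζ => (symbolPartial 0 ζ)⁻¹ * ((t ^ 2 / ((absX ζ)⁻¹ ^ 2 + t ^ 2) : ℝ) : ℂ) *
      symbolPartial 1 ζ) (by fun_prop) (c := t / 2) (by positivity) (fun ζ => by
      have h0 : 0 ≤ (absX ζ)⁻¹ := inv_nonneg.2 (absX_nonneg ζ)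
      rw [norm_symbolB_sq, ← mul_assoc, norm_mul, norm_mul, mul_pow, norm_inv,
        norm_symbolPartial_zero, Complex.norm_real, Real.norm_of_nonneg (by positivity)]
      gcongr
      exact interpolation_weight_mul_sq_le h0 ht) hu)
  obtain ⟨h, hh⟩ := exists_fourier_eq (memLp_mul_of_norm_sq_le_symbolB
    (m := fun ζ => (((absX ζ)⁻¹ ^ 2 / ((absX ζ)⁻¹ ^ 2 + t ^ 2) : ℝ) : ℂ) *
      symbolPartial 1 ζ) (by fun_prop) (c := (2 * t)⁻¹) (by positivity) (fun ζ => by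
      have h0 : 0 ≤ (absX ζ)⁻¹ := inv_nonneg.2 (absX_nonneg ζ)
      rw [norm_symbolB_sq, ← mul_assoc, norm_mul, mul_pow,
        Complex.norm_real, Real.norm_of_nonneg (by positivity)]
      gcongr
      exact interpolation_weight_sq_le h0 ht) hu)
  have hav : (fun ζ => symbolPartial 1 ζ * (𝓕 a : L2 ℂ) ζ) =ᵐ[volume]
      fun ζ => symbolPartial 0 ζ * (𝓕 v : L2 ℂ) ζ := by
    filter_upwards [ha, hv, ae_apply_zero_ne_zero] with ζ h1 h2 h3
    have h0 : symbolPartial 0 ζ ≠ 0 := by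
      simp [symbolPartial, h3, Real.pi_ne_zero]
    rw [h1, h2]
    field_simp
  have hbh : (𝓕 h : L2 ℂ) =ᵐ[volume] fun ζ => symbolPartial 1 ζ * (𝓕 b : L2 ℂ) ζ := by
    filter_upwards [hb, hh] with ζ h1 h2
    rw [h1, h2]
    ring
  refine ⟨fun i => cutDeriv 1 (χ i) a, fun i => cutDeriv 1 (χ i) b,
    fun i => aemeasurable_cutDeriv _ _ _, fun i => aemeasurable_cutDeriv _ _ _, fun i => ?_,
    ?_, ?_⟩
  · rw [hab]
    exact cutDeriv_add _ _ _ _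
  · refine (tsum_lintegral_absShift_div_sq_cutDeriv_le hχ hχ' hL hav).trans_eq ?_
    congr 1
    apply lintegral_congr_ae
    filter_upwards [hv] with ζ hζ
    rw [hζ, mul_assoc, mul_assoc, enorm_mul_sq]
    congr 1
    rw [enorm_sq_eq_ofReal, norm_inv, norm_symbolPartial_zero]
  · have e : ∀ i, ∫⁻ ζ, ‖cutDeriv 1 (χ i) b ζ‖ₑ ^ 2 =
        ∫⁻ ζ, ‖(𝓕 (cut (χ i) h) : L2 ℂ) ζ‖ₑ ^ 2 := by
      intro i
      apply lintegral_congr_ae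
      filter_upwards [cutDeriv_eq_fourier_cut (χ i) hbh] with ζ hζ
      rw [hζ]
    simp_rw [e]
    refine (tsum_lintegral_fourier_cut_le hχ h).trans ?_
    -- This endpoint needs only the constant `K`; it is enlarged to match the other one.
    refine mul_le_mul' (le_mul_of_one_le_left' ?_) (lintegral_mono_ae ?_)
    · refine one_le_mul (by norm_num) ?_
      rw [ENNReal.one_le_ofReal]
      nlinarith
    · filter_upwards [hh] with ζ hζ
      rw [hζ, mul_assoc]
      exact le_rfl

end Family

/-! ### Estimates for the corrected extensions -/

section Localization

variable {χ : ℕ → 𝓢(Plane, ℂ)} {K : ℝ≥0∞} {L : ℝ} {u : L2 ℂ} {g : ℕ → L2 ℂ}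

theorem enorm_one_sub_shiftSymbol_sq (L : ℝ) (ζ : Plane) :
    ‖1 - shiftSymbol (shiftVec L) ζ‖ₑ ^ 2 = ENNReal.ofReal (absShift L ζ ^ 2) :=
  enorm_sq_eq_ofReal _

theorem enorm_one_sub_shiftSymbol_sq_le (L : ℝ) (ζ : Plane) :
    ‖1 - shiftSymbol (shiftVec L) ζ‖ₑ ^ 2 ≤ 4 := by
  rw [enorm_one_sub_shiftSymbol_sq, show (4 : ℝ≥0∞) = ENNReal.ofReal 4 by simp]
  apply ENNReal.ofReal_le_ofReal
  nlinarith [absShift_nonneg L ζ, absShift_le_two L ζ]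

theorem one_le_ofReal_four_add_sq (L : ℝ) : 1 ≤ ENNReal.ofReal (4 + L ^ 2) := by
  rw [ENNReal.one_le_ofReal]; nlinarith

theorem tsum_lintegral_localization_le (hχ : ∀ z, ∑' i, ‖χ i z‖ₑ ^ 2 ≤ K)
    (hg : ∀ i, (𝓕 (g i) : L2 ℂ) =ᵐ[volume] fun ζ =>
      (1 - shiftSymbol (shiftVec L) ζ) * (𝓕 (cut (χ i) u) : L2 ℂ) ζ) :
    ∑' i, ∫⁻ ζ, ‖(𝓕 (g i) : L2 ℂ) ζ‖ₑ ^ 2 ≤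
      16 * ENNReal.ofReal (4 + L ^ 2) * K * ∫⁻ ζ, ‖(𝓕 u : L2 ℂ) ζ‖ₑ ^ 2 := by
  calc _ ≤ ∑' i, 4 * ∫⁻ ζ, ‖(𝓕 (cut (χ i) u) : L2 ℂ) ζ‖ₑ ^ 2 := by
        refine ENNReal.tsum_le_tsum fun i => ?_
        have h1 := aemeasurable_L2 (𝓕 (cut (χ i) u) : L2 ℂ)
        rw [← lintegral_const_mul'' _ (by fun_prop)]
        apply lintegral_mono_ae
        filter_upwards [hg i] with ζ hζ
        rw [hζ, enorm_mul_sq]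
        gcongr
        exact enorm_one_sub_shiftSymbol_sq_le L ζ
    _ ≤ 4 * (K * ∫⁻ ζ, ‖(𝓕 u : L2 ℂ) ζ‖ₑ ^ 2) := by
        rw [ENNReal.tsum_mul_left]
        gcongr
        exact tsum_lintegral_fourier_cut_le hχ u
    _ = 4 * 1 * K * ∫⁻ ζ, ‖(𝓕 u : L2 ℂ) ζ‖ₑ ^ 2 := by ring
    _ ≤ _ := by
        gcongr
        · norm_num
        · exact one_le_ofReal_four_add_sq L

theorem tsum_lintegral_symbolA_localization_le (hχ : ∀ z, ∑' i, ‖χ i z‖ₑ ^ 2 ≤ K)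
    (hχ' : ∀ j z, ∑' i, ‖(∂_{unitVec j} (χ i)) z‖ₑ ^ 2 ≤ K)
    (hg : ∀ i, (𝓕 (g i) : L2 ℂ) =ᵐ[volume] fun ζ =>
      (1 - shiftSymbol (shiftVec L) ζ) * (𝓕 (cut (χ i) u) : L2 ℂ) ζ) :
    ∑' i, ∫⁻ ζ, ‖symbolA ζ * (𝓕 (g i) : L2 ℂ) ζ‖ₑ ^ 2 ≤
      16 * ENNReal.ofReal (4 + L ^ 2) * K * ((∫⁻ ζ, ‖(𝓕 u : L2 ℂ) ζ‖ₑ ^ 2) +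
        ∫⁻ ζ, ‖symbolA ζ * (𝓕 u : L2 ℂ) ζ‖ₑ ^ 2) := by
  have hX := measurable_absX
  calc _ ≤ ∑' i, 4 * ∫⁻ ζ, ENNReal.ofReal (absX ζ) * ‖(𝓕 (cut (χ i) u) : L2 ℂ) ζ‖ₑ ^ 2 := by
        refine ENNReal.tsum_le_tsum fun i => ?_
        have h1 := aemeasurable_L2 (𝓕 (cut (χ i) u) : L2 ℂ)
        rw [← lintegral_const_mul'' _ (by fun_prop)]
        apply lintegral_mono_ae
        filter_upwards [hg i] with ζ hζ
        rw [hζ, enorm_mul_sq, enorm_mul_sq, enorm_symbolA_sq, mul_left_comm]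
        gcongr
        exact enorm_one_sub_shiftSymbol_sq_le L ζ
    _ ≤ 4 * (2 * K * ∫⁻ ζ, ENNReal.ofReal √(1 + absX ζ ^ 2) * ‖(𝓕 u : L2 ℂ) ζ‖ₑ ^ 2) := by
        rw [ENNReal.tsum_mul_left]
        gcongr
        exact tsum_lintegral_absX_fourier_cut_le hχ hχ' u
    _ ≤ 4 * (2 * K * ((∫⁻ ζ, ‖(𝓕 u : L2 ℂ) ζ‖ₑ ^ 2) +
        ∫⁻ ζ, ‖symbolA ζ * (𝓕 u : L2 ℂ) ζ‖ₑ ^ 2)) := by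
        have h1 := aemeasurable_L2 (𝓕 u : L2 ℂ)
        rw [← lintegral_add_left' (by fun_prop)]
        gcongr with ζ
        rw [enorm_mul_sq, enorm_symbolA_sq, ← one_add_mul, ← ENNReal.ofReal_one,
          ← ENNReal.ofReal_add zero_le_one (absX_nonneg ζ)]
        gcongr
        have := absX_nonneg ζ
        rw [Real.sqrt_le_left (by positivity)]
        nlinarith
    _ = 8 * 1 * K * ((∫⁻ ζ, ‖(𝓕 u : L2 ℂ) ζ‖ₑ ^ 2) +
        ∫⁻ ζ, ‖symbolA ζ * (𝓕 u : L2 ℂ) ζ‖ₑ ^ 2) := by ring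
    _ ≤ _ := by
        gcongr
        · norm_num
        · exact one_le_ofReal_four_add_sq L

theorem symbolPartial_one_mul_fourier_cut (χ : 𝓢(Plane, ℂ)) (u : L2 ℂ) (ζ : Plane) :
    symbolPartial 1 ζ * (𝓕 (cut χ u) : L2 ℂ) ζ = cutDeriv 1 χ u ζ +
      (𝓕 (cut (∂_{unitVec 1} χ) u) : L2 ℂ) ζ := by
  simp [cutDeriv]

theorem absShift_sq_div_le_two_mul (L : ℝ) (ζ : Plane) :
    (absX ζ)⁻¹ * absShift L ζ ^ 2 ≤ 2 * (absShift L ζ / absX ζ) := by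
  calc _ = absShift L ζ * (absShift L ζ / absX ζ) := by ring
    _ ≤ _ := by
        gcongr
        · exact absShift_div_nonneg L ζ
        · exact absShift_le_two L ζ

/-- After `∂_y(χ u) = χ ∂_y u + (∂_y χ) u`, the weight is `absShift² / absX`. One factor `absShift ≤
2` is spent to reach the interpolated weight `absShift / absX`, which is at most `L` on the
commutator term. -/
theorem tsum_lintegral_symbolB_localization_le (hχ : ∀ z, ∑' i, ‖χ i z‖ₑ ^ 2 ≤ K)
    (hχ' : ∀ j z, ∑' i, ‖(∂_{unitVec j} (χ i)) z‖ₑ ^ 2 ≤ K) (hL : 0 ≤ L)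
    (hg : ∀ i, (𝓕 (g i) : L2 ℂ) =ᵐ[volume] fun ζ =>
      (1 - shiftSymbol (shiftVec L) ζ) * (𝓕 (cut (χ i) u) : L2 ℂ) ζ)
    (hu : MemLp (fun ζ => symbolB ζ * (𝓕 u : L2 ℂ) ζ) 2 volume) :
    ∑' i, ∫⁻ ζ, ‖symbolB ζ * (𝓕 (g i) : L2 ℂ) ζ‖ₑ ^ 2 ≤
      16 * ENNReal.ofReal (4 + L ^ 2) * K * ((∫⁻ ζ, ‖(𝓕 u : L2 ℂ) ζ‖ₑ ^ 2) +
        ∫⁻ ζ, ‖symbolB ζ * (𝓕 u : L2 ℂ) ζ‖ₑ ^ 2) := by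
  have hX := measurable_absX
  have hS := measurable_absShift L
  calc _ ≤ ∑' i, (4 * ENNReal.ofReal L *
          (∫⁻ ζ, ‖(𝓕 (cut (∂_{unitVec 1} (χ i)) u) : L2 ℂ) ζ‖ₑ ^ 2) + 4 *
          ∫⁻ ζ, ENNReal.ofReal (absShift L ζ / absX ζ) * ‖cutDeriv 1 (χ i) u ζ‖ₑ ^ 2) := by
        refine ENNReal.tsum_le_tsum fun i => ?_
        have h1 := aemeasurable_L2 (𝓕 (cut (∂_{unitVec 1} (χ i)) u) : L2 ℂ)
        have h2 := aemeasurable_cutDeriv 1 (χ i) u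
        rw [← lintegral_const_mul'' _ (by fun_prop), ← lintegral_const_mul'' _ (by fun_prop),
          ← lintegral_add_left' (by fun_prop)]
        apply lintegral_mono_ae
        filter_upwards [hg i] with ζ hζ
        rw [hζ, enorm_mul_sq, enorm_mul_sq, enorm_symbolB_sq, enorm_one_sub_shiftSymbol_sq,
          show ∀ a b c d : ℝ≥0∞, a * b * (c * d) = (a * c) * (b * d) by intros; ring,
          ← enorm_mul_sq, symbolPartial_one_mul_fourier_cut,
          ← ENNReal.ofReal_mul (inv_nonneg.2 (absX_nonneg ζ))]
        have e1 : ENNReal.ofReal ((absX ζ)⁻¹ * absShift L ζ ^ 2) ≤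
            2 * ENNReal.ofReal (absShift L ζ / absX ζ) := by
          rw [show (2 : ℝ≥0∞) = ENNReal.ofReal 2 by simp, ← ENNReal.ofReal_mul (by norm_num)]
          exact ENNReal.ofReal_le_ofReal (absShift_sq_div_le_two_mul L ζ)
        have e2 : ENNReal.ofReal (absShift L ζ / absX ζ) ≤ ENNReal.ofReal L :=
          ENNReal.ofReal_le_ofReal (absShift_div_le hL ζ)
        calc _ ≤ (2 * ENNReal.ofReal (absShift L ζ / absX ζ)) * (2 * ‖cutDeriv 1 (χ i) u ζ‖ₑ ^ 2 +
              2 * ‖(𝓕 (cut (∂_{unitVec 1} (χ i)) u) : L2 ℂ) ζ‖ₑ ^ 2) :=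
              mul_le_mul' e1 (enorm_add_sq_le _ _)
          _ = 4 * ENNReal.ofReal (absShift L ζ / absX ζ) *
              ‖(𝓕 (cut (∂_{unitVec 1} (χ i)) u) : L2 ℂ) ζ‖ₑ ^ 2 +
              4 * (ENNReal.ofReal (absShift L ζ / absX ζ) * ‖cutDeriv 1 (χ i) u ζ‖ₑ ^ 2) := by
              ring
          _ ≤ _ := by gcongr
    _ ≤ 4 * ENNReal.ofReal L * (K * ∫⁻ ζ, ‖(𝓕 u : L2 ℂ) ζ‖ₑ ^ 2) +
        4 * (4 * ENNReal.ofReal (4 + L ^ 2) * K *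
        ∫⁻ ζ, ENNReal.ofReal (absX ζ)⁻¹ * ‖symbolPartial 1 ζ * (𝓕 u : L2 ℂ) ζ‖ₑ ^ 2) := by
        rw [ENNReal.tsum_add, ENNReal.tsum_mul_left, ENNReal.tsum_mul_left]
        gcongr
        · exact tsum_lintegral_fourier_cut_le (hχ' 1) u
        · exact tsum_lintegral_absShift_div_cutDeriv_le hχ hχ' hL hu
    _ ≤ 16 * ENNReal.ofReal (4 + L ^ 2) * (K * ∫⁻ ζ, ‖(𝓕 u : L2 ℂ) ζ‖ₑ ^ 2) +
        4 * (4 * ENNReal.ofReal (4 + L ^ 2) * K *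
        ∫⁻ ζ, ENNReal.ofReal (absX ζ)⁻¹ * ‖symbolPartial 1 ζ * (𝓕 u : L2 ℂ) ζ‖ₑ ^ 2) := by
        gcongr
        · norm_num
        · nlinarith [sq_nonneg (L - 1)]
    _ = _ := by
        have e : ∀ ζ, ‖symbolB ζ * (𝓕 u : L2 ℂ) ζ‖ₑ ^ 2 =
            ENNReal.ofReal (absX ζ)⁻¹ * ‖symbolPartial 1 ζ * (𝓕 u : L2 ℂ) ζ‖ₑ ^ 2 := by
          intro ζ
          rw [enorm_mul_sq, enorm_symbolB_sq, enorm_mul_sq, mul_assoc]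
        simp_rw [e]
        ring

/-- No interpolation is needed: `v = ∂_x^{-1} ∂_y u` is itself in `L²`, and the weight is `(absShift
/ absX)²`. -/
theorem tsum_lintegral_symbolC_localization_le (hχ : ∀ z, ∑' i, ‖χ i z‖ₑ ^ 2 ≤ K)
    (hχ' : ∀ j z, ∑' i, ‖(∂_{unitVec j} (χ i)) z‖ₑ ^ 2 ≤ K) (hL : 0 ≤ L)
    (hg : ∀ i, (𝓕 (g i) : L2 ℂ) =ᵐ[volume] fun ζ =>
      (1 - shiftSymbol (shiftVec L) ζ) * (𝓕 (cut (χ i) u) : L2 ℂ) ζ)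
    (hu : MemLp (fun ζ => symbolC ζ * (𝓕 u : L2 ℂ) ζ) 2 volume) :
    ∑' i, ∫⁻ ζ, ‖symbolC ζ * (𝓕 (g i) : L2 ℂ) ζ‖ₑ ^ 2 ≤
      16 * ENNReal.ofReal (4 + L ^ 2) * K * ((∫⁻ ζ, ‖(𝓕 u : L2 ℂ) ζ‖ₑ ^ 2) +
        ∫⁻ ζ, ‖symbolC ζ * (𝓕 u : L2 ℂ) ζ‖ₑ ^ 2) := by
  have hX := measurable_absX
  have hS := measurable_absShift L
  obtain ⟨v, hv⟩ := exists_fourier_eq hu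
  have huv : (fun ζ => symbolPartial 1 ζ * (𝓕 u : L2 ℂ) ζ) =ᵐ[volume]
      fun ζ => symbolPartial 0 ζ * (𝓕 v : L2 ℂ) ζ := by
    filter_upwards [hv, ae_apply_zero_ne_zero] with ζ h2 h3
    have h0 : symbolPartial 0 ζ ≠ 0 := by
      simp [symbolPartial, h3, Real.pi_ne_zero]
    rw [h2, show symbolC ζ = (symbolPartial 0 ζ)⁻¹ * symbolPartial 1 ζ from rfl]
    field_simp
  calc _ ≤ ∑' i, (2 * ENNReal.ofReal (L ^ 2) *
          (∫⁻ ζ, ‖(𝓕 (cut (∂_{unitVec 1} (χ i)) u) : L2 ℂ) ζ‖ₑ ^ 2) + 2 *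
          ∫⁻ ζ, ENNReal.ofReal ((absShift L ζ / absX ζ) ^ 2) *
            ‖cutDeriv 1 (χ i) u ζ‖ₑ ^ 2) := by
        refine ENNReal.tsum_le_tsum fun i => ?_
        have h1 := aemeasurable_L2 (𝓕 (cut (∂_{unitVec 1} (χ i)) u) : L2 ℂ)
        have h2 := aemeasurable_cutDeriv 1 (χ i) u
        rw [← lintegral_const_mul'' _ (by fun_prop), ← lintegral_const_mul'' _ (by fun_prop),
          ← lintegral_add_left' (by fun_prop)]
        apply lintegral_mono_ae
        filter_upwards [hg i] with ζ hζ
        rw [hζ, enorm_mul_sq, enorm_mul_sq, enorm_symbolC_sq, enorm_one_sub_shiftSymbol_sq,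
          show ∀ a b c d : ℝ≥0∞, a * b * (c * d) = (a * c) * (b * d) by intros; ring,
          ← enorm_mul_sq, symbolPartial_one_mul_fourier_cut,
          ← ENNReal.ofReal_mul (sq_nonneg _), ← mul_pow, inv_mul_eq_div]
        have e2 : ENNReal.ofReal ((absShift L ζ / absX ζ) ^ 2) ≤ ENNReal.ofReal (L ^ 2) :=
          ENNReal.ofReal_le_ofReal
            (pow_le_pow_left₀ (absShift_div_nonneg L ζ) (absShift_div_le hL ζ) 2)
        calc _ ≤ ENNReal.ofReal ((absShift L ζ / absX ζ) ^ 2) *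
              (2 * ‖cutDeriv 1 (χ i) u ζ‖ₑ ^ 2 +
              2 * ‖(𝓕 (cut (∂_{unitVec 1} (χ i)) u) : L2 ℂ) ζ‖ₑ ^ 2) :=
              mul_le_mul' le_rfl (enorm_add_sq_le _ _)
          _ = 2 * ENNReal.ofReal ((absShift L ζ / absX ζ) ^ 2) *
              ‖(𝓕 (cut (∂_{unitVec 1} (χ i)) u) : L2 ℂ) ζ‖ₑ ^ 2 +
              2 * (ENNReal.ofReal ((absShift L ζ / absX ζ) ^ 2) *
                ‖cutDeriv 1 (χ i) u ζ‖ₑ ^ 2) := by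
              ring
          _ ≤ _ := by gcongr
    _ ≤ 2 * ENNReal.ofReal (L ^ 2) * (K * ∫⁻ ζ, ‖(𝓕 u : L2 ℂ) ζ‖ₑ ^ 2) +
        2 * (4 * ENNReal.ofReal (4 + L ^ 2) * K * ∫⁻ ζ, ‖(𝓕 v : L2 ℂ) ζ‖ₑ ^ 2) := by
        rw [ENNReal.tsum_add, ENNReal.tsum_mul_left, ENNReal.tsum_mul_left]
        gcongr
        · exact tsum_lintegral_fourier_cut_le (hχ' 1) u
        · exact tsum_lintegral_absShift_div_sq_cutDeriv_le hχ hχ' hL huv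
    _ ≤ 8 * ENNReal.ofReal (4 + L ^ 2) * (K * ∫⁻ ζ, ‖(𝓕 u : L2 ℂ) ζ‖ₑ ^ 2) +
        2 * (4 * ENNReal.ofReal (4 + L ^ 2) * K * ∫⁻ ζ, ‖(𝓕 v : L2 ℂ) ζ‖ₑ ^ 2) := by
        gcongr
        · norm_num
        · linarith
    _ = 8 * ENNReal.ofReal (4 + L ^ 2) * K * ((∫⁻ ζ, ‖(𝓕 u : L2 ℂ) ζ‖ₑ ^ 2) +
        ∫⁻ ζ, ‖symbolC ζ * (𝓕 u : L2 ℂ) ζ‖ₑ ^ 2) := by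
        have e : ∫⁻ ζ, ‖symbolC ζ * (𝓕 u : L2 ℂ) ζ‖ₑ ^ 2 = ∫⁻ ζ, ‖(𝓕 v : L2 ℂ) ζ‖ₑ ^ 2 := by
          apply lintegral_congr_ae
          filter_upwards [hv] with ζ hζ
          rw [hζ]
        rw [e]
        ring
    _ ≤ _ := by
        gcongr
        norm_num

end Localization

/-! ### Overlap of the cutoffs -/

/-- The first step of size `R / 2` that carries `z` beyond `c` overshoots by at most `R / 2`. -/
theorem exists_mem_Icc_mul_mem_Ioo {R c z : ℝ} (hR : 0 < R) (h : |z - (c + R / 2)| ≤ 2 * R) :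
    ∃ m ∈ Finset.Icc (-4 : ℤ) 4, c < z + m * (R / 2) ∧ z + m * (R / 2) < c + R := by
  obtain ⟨h1, h2⟩ := abs_le.1 h
  have hR2 : 0 < R / 2 := by positivity
  have f1 := Int.floor_le ((c - z) / (R / 2))
  have f2 := Int.lt_floor_add_one ((c - z) / (R / 2))
  rw [le_div_iff₀ hR2] at f1
  rw [div_lt_iff₀ hR2] at f2
  refine ⟨⌊(c - z) / (R / 2)⌋ + 1, Finset.mem_Icc.2 ⟨?_, ?_⟩, ?_, ?_⟩
  -- The hypothesis gives `-5R/2 ≤ c - z ≤ 3R/2`, so the floor lies between -5 and 3.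
  · have : (-5 : ℤ) ≤ ⌊(c - z) / (R / 2)⌋ := by
      rw [Int.le_floor, le_div_iff₀ hR2]
      push_cast; linarith
    omega
  · have : ⌊(c - z) / (R / 2)⌋ < 4 := by
      rw [Int.floor_lt, div_lt_iff₀ hR2]
      push_cast; linarith
    omega
  · push_cast; linarith
  · push_cast; linarith

theorem tsum_indicator_one_eq_encard {ι : Type*} (s : Set ι) :
    ∑' i, s.indicator (fun _ => (1 : ℝ≥0∞)) i = s.encard := by
  rw [← tsum_subtype, ENNReal.tsum_set_one]

/-- The center of a square with lower left corner `c` and side `R`. -/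
noncomputable def squareCenter (c : Plane) (R : ℝ) : Plane :=
  c + WithLp.toLp 2 (fun _ => R / 2)

theorem squareCenter_apply (c : Plane) (R : ℝ) (j : Fin 2) :
    squareCenter c R j = c j + R / 2 := rfl

/-- If the `i`-th bump is nonzero at `z`, one of the 81 translates of `z` by a grid of mesh `R / 2`
lies in the `i`-th square. Each translate lies in at most 3 squares, whence `243 = 81 · 3`. -/
theorem tsum_enorm_sq_comp_sub_squareCenter_le {R : ℝ} (hR : 0 < R) {c : ℕ → Plane}
    (hc : ∀ z : Plane, {i : ℕ | z ∈ square (c i) R}.encard ≤ 3) {ψ : Plane → ℂ} {M : ℝ≥0∞}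
    (hM : ∀ z, ‖ψ z‖ₑ ^ 2 ≤ M) (hψ : ∀ z, 2 * R < ‖z‖ → ψ z = 0) (z : Plane) :
    ∑' i, ‖ψ (z - squareCenter (c i) R)‖ₑ ^ 2 ≤ 243 * M := by
  set P : Finset (ℤ × ℤ) := Finset.Icc (-4 : ℤ) 4 ×ˢ Finset.Icc (-4 : ℤ) 4 with hP
  set T : ℤ × ℤ → Set ℕ := fun m =>
    {i | z + WithLp.toLp 2 ![m.1 * (R / 2), m.2 * (R / 2)] ∈ square (c i) R} with hT
  have key : ∀ i, ‖ψ (z - squareCenter (c i) R)‖ₑ ^ 2 ≤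
      ∑ m ∈ P, M * (T m).indicator (fun _ => (1 : ℝ≥0∞)) i := by
    intro i
    by_cases hz : 2 * R < ‖z - squareCenter (c i) R‖
    · rw [hψ _ hz]; simp
    push Not at hz
    have hj : ∀ j : Fin 2, |z j - (c i j + R / 2)| ≤ 2 * R := fun j =>
      (PiLp.norm_apply_le (z - squareCenter (c i) R) j).trans hz
    obtain ⟨m0, hm0, h0, h0'⟩ := exists_mem_Icc_mul_mem_Ioo hR (hj 0)
    obtain ⟨m1, hm1, h1, h1'⟩ := exists_mem_Icc_mul_mem_Ioo hR (hj 1)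
    have hmem : i ∈ T (m0, m1) := by
      intro j
      fin_cases j
      · simpa using ⟨h0, h0'⟩
      · simpa using ⟨h1, h1'⟩
    calc _ ≤ M := hM _
      _ = M * (T (m0, m1)).indicator (fun _ => (1 : ℝ≥0∞)) i := by
          rw [Set.indicator_of_mem hmem, mul_one]
      _ ≤ _ := Finset.single_le_sum
          (f := fun m => M * (T m).indicator (fun _ => (1 : ℝ≥0∞)) i) (fun _ _ => zero_le)
          (Finset.mem_product.2 ⟨hm0, hm1⟩)
  calc _ ≤ ∑' i, ∑ m ∈ P, M * (T m).indicator (fun _ => (1 : ℝ≥0∞)) i :=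
        ENNReal.tsum_le_tsum key
    _ = ∑ m ∈ P, M * ((T m).encard : ℝ≥0∞) := by
        rw [Summable.tsum_finsetSum fun _ _ => ENNReal.summable]
        simp_rw [ENNReal.tsum_mul_left, tsum_indicator_one_eq_encard]
    _ ≤ ∑ m ∈ P, M * 3 := by
        gcongr with m
        exact_mod_cast hc _
    _ = _ := by
        have : P.card = 81 := by rw [hP, Finset.card_product]; rfl
        rw [Finset.sum_const, this, nsmul_eq_mul]
        push_cast
        ring

theorem exists_enorm_sq_le (ψ : 𝓢(Plane, ℂ)) : ∃ M : ℝ≥0∞, M ≠ ⊤ ∧ ∀ z, ‖ψ z‖ₑ ^ 2 ≤ M := by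
  refine ⟨ENNReal.ofReal (‖ψ.toBoundedContinuousFunction‖ ^ 2), ENNReal.ofReal_ne_top, fun z => ?_⟩
  rw [enorm_sq_eq_ofReal]
  gcongr
  exact ψ.toBoundedContinuousFunction.norm_coe_le_norm z

theorem lineDerivOp_compSubConst (ψ : 𝓢(Plane, ℂ)) (a m z : Plane) :
    (∂_{m} (SchwartzMap.compSubConstCLM ℂ a ψ)) z = (∂_{m} ψ) (z - a) := by
  rw [SchwartzMap.lineDerivOp_apply_eq_fderiv, SchwartzMap.lineDerivOp_apply_eq_fderiv]
  have : ((SchwartzMap.compSubConstCLM ℂ a ψ : 𝓢(Plane, ℂ)) : Plane → ℂ) = fun x => ψ (x - a) :=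
    funext fun x => SchwartzMap.compSubConstCLM_apply ..
  rw [this, fderiv_comp_sub]

theorem exists_uniform_cutoff_bound {R : ℝ} (hR : 0 < R) (ψ : 𝓢(Plane, ℂ))
    (hψ : tsupport ψ ⊆ Metric.closedBall 0 (2 * R)) :
    ∃ K : ℝ≥0∞, K ≠ ⊤ ∧ ∀ c : ℕ → Plane,
      (∀ z : Plane, {i : ℕ | z ∈ square (c i) R}.encard ≤ 3) →
      (∀ z, ∑' i, ‖SchwartzMap.compSubConstCLM ℂ (squareCenter (c i) R) ψ z‖ₑ ^ 2 ≤ K) ∧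
      ∀ j z, ∑' i, ‖(∂_{unitVec j} (SchwartzMap.compSubConstCLM ℂ
        (squareCenter (c i) R) ψ)) z‖ₑ ^ 2 ≤ K := by
  have van : ∀ φ : 𝓢(Plane, ℂ), tsupport φ ⊆ tsupport ψ → ∀ z, 2 * R < ‖z‖ → φ z = 0 := by
    intro φ hφ z hz
    by_contra h0
    have := hψ (hφ (subset_tsupport _ h0))
    rw [mem_closedBall_zero_iff] at this
    linarith
  obtain ⟨M, hM, hMψ⟩ := exists_enorm_sq_le ψ
  choose N hN hNψ using fun j => exists_enorm_sq_le (∂_{unitVec j} ψ)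
  refine ⟨243 * (M + ∑ j, N j), ENNReal.mul_ne_top (by norm_num)
    (ENNReal.add_ne_top.2 ⟨hM, ENNReal.sum_ne_top.2 fun j _ => hN j⟩), fun c hc => ⟨fun z => ?_,
    fun j z => ?_⟩⟩
  · exact tsum_enorm_sq_comp_sub_squareCenter_le hR hc
      (fun z => (hMψ z).trans le_self_add) (van ψ subset_rfl) z
  · simp_rw [lineDerivOp_compSubConst]
    refine tsum_enorm_sq_comp_sub_squareCenter_le hR hc
      (fun z => (hNψ j z).trans ?_) (van _ (SchwartzMap.tsupport_lineDerivOp_subset _ _)) z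
    exact (Finset.single_le_sum (f := N) (fun _ _ => zero_le) (Finset.mem_univ j)).trans
      le_add_self

/-! ### Real or complex scalars, the extension, and the norms -/

variable {𝕜 : Type*} [RCLike 𝕜]

theorem coeFn_toComplex (f : L2 𝕜) :
    toComplex f =ᵐ[volume] fun z => RCLike.map 𝕜 ℂ (f z) :=
  ContinuousLinearMap.coeFn_compLp _ _

theorem norm_rclike_map (a : 𝕜) : ‖RCLike.map 𝕜 ℂ a‖ = ‖a‖ := by
  rw [← sq_eq_sq₀ (norm_nonneg _) (norm_nonneg _), RCLike.norm_sq_eq_def (z := a), Complex.sq_norm,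
    Complex.normSq_apply]
  simp [RCLike.map_apply]

theorem rclike_map_ofReal_mul (r : ℝ) (a : 𝕜) :
    RCLike.map 𝕜 ℂ ((r : 𝕜) * a) = (r : ℂ) * RCLike.map 𝕜 ℂ a := by
  rw [← RCLike.real_smul_eq_coe_mul, map_smul, Complex.real_smul]

theorem norm_hat (f : L2 𝕜) : ‖hat f‖ = ‖f‖ := by
  rw [hat, Lp.norm_fourier_eq]
  apply le_antisymm <;> apply Lp.norm_le_norm_of_ae_le <;>
  · filter_upwards [coeFn_toComplex f] with z hz
    rw [hz, norm_rclike_map]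

/-- The corrected extension. The cutoff `b` is real, so `g` keeps values in `𝕜` and the real case
needs no separate argument. -/
theorem exists_eq_mul_cutoff_sub_shift (f : L2 𝕜) (φ : 𝓢(Plane, ℂ)) (b : Plane → ℝ)
    (hb : Continuous b) (hφ : ∀ z, φ z = b z) (a : Plane) :
    ∃ g : L2 𝕜, (g =ᵐ[volume] fun z => (b z : 𝕜) * f z - (b (z - a) : 𝕜) * f (z - a)) ∧
      hat g =ᵐ[volume] fun ζ =>
        (1 - shiftSymbol a ζ) * (𝓕 (cut φ (toComplex f)) : L2 ℂ) ζ := by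
  obtain ⟨M, hM⟩ : ∃ M, ∀ z, ‖b z‖ ≤ M := by
    refine ⟨‖φ.toBoundedContinuousFunction‖, fun z => ?_⟩
    have := φ.toBoundedContinuousFunction.norm_coe_le_norm z
    rwa [SchwartzMap.toBoundedContinuousFunction_apply, hφ, Complex.norm_real] at this
  have hbm : Measurable b := hb.measurable
  have hfm : AEMeasurable f volume := (Lp.aestronglyMeasurable f).aemeasurable
  have h1 : MemLp (fun z => (b z : 𝕜) * f z) 2 volume := by
    refine (Lp.memLp f).of_le_mul (c := M) (AEMeasurable.aestronglyMeasurable (by fun_prop))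
      (Filter.Eventually.of_forall fun z => ?_)
    rw [norm_mul, RCLike.norm_ofReal]
    gcongr
    exact hM z
  have hmp := measurePreserving_sub_right (volume : Measure Plane) a
  have h2 : MemLp (fun z => (b (z - a) : 𝕜) * f (z - a)) 2 volume :=
    h1.comp_measurePreserving hmp
  have h3 : MemLp (fun z => cut φ (toComplex f) (z - a)) 2 volume :=
    (Lp.memLp (cut φ (toComplex f))).comp_measurePreserving hmp
  have hg := (h1.sub h2).coeFn_toLp
  refine ⟨(h1.sub h2).toLp _, hg, ?_⟩
  have e : toComplex ((h1.sub h2).toLp _) = cut φ (toComplex f) - h3.toLp _ := by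
    apply Lp.ext
    have hf := coeFn_toComplex f
    have hc := coeFn_cut φ (toComplex f)
    filter_upwards [coeFn_toComplex ((h1.sub h2).toLp _), hg, hf, hc,
      hmp.quasiMeasurePreserving.ae hf, hmp.quasiMeasurePreserving.ae hc,
      Lp.coeFn_sub (cut φ (toComplex f)) (h3.toLp _), h3.coeFn_toLp]
      with z e1 e2 e3 e4 e5 e6 e7 e8
    rw [e1, e2, e7, Pi.sub_apply, Pi.sub_apply, e8, e4, e6, e3, e5, map_sub,
      rclike_map_ofReal_mul, rclike_map_ofReal_mul, hφ, hφ]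
  have e' : hat ((h1.sub h2).toLp _) = 𝓕 (cut φ (toComplex f)) - 𝓕 (h3.toLp _) := by
    rw [hat, e]
    exact map_sub (Lp.fourierTransformₗᵢ Plane ℂ) _ _
  rw [e']
  filter_upwards [Lp.coeFn_sub (𝓕 (cut φ (toComplex f)) : L2 ℂ) (𝓕 (h3.toLp _)),
    fourier_shift h3.coeFn_toLp] with ζ e1 e2
  rw [e1, Pi.sub_apply, e2]
  ring

theorem memLp_two_of_lintegral_lt_top {F : Plane → ℂ} (hF : AEMeasurable F volume)
    (h : ∫⁻ ζ, ‖F ζ‖ₑ ^ 2 < ⊤) : MemLp F 2 volume := by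
  refine ⟨hF.aestronglyMeasurable, ?_⟩
  rw [eLpNorm_lt_top_iff_lintegral_rpow_enorm_lt_top (by norm_num) (by norm_num)]
  simpa using h

theorem MultiplierMem.of_lintegral_lt_top {m : Plane → ℂ} (hm : Measurable m) {f : L2 𝕜}
    (h : ∫⁻ ζ, ‖m ζ * hat f ζ‖ₑ ^ 2 < ⊤) : MultiplierMem m f :=
  memLp_two_of_lintegral_lt_top (hm.aemeasurable.mul (aemeasurable_L2 _)) h

theorem MultiplierMem.lintegral_lt_top {m : Plane → ℂ} {f : L2 𝕜} (h : MultiplierMem m f) :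
    ∫⁻ ζ, ‖m ζ * hat f ζ‖ₑ ^ 2 < ⊤ := by
  have := (eLpNorm_lt_top_iff_lintegral_rpow_enorm_lt_top (by norm_num) (by norm_num)).1 h.2
  simpa using this

theorem MultiplierMem.ofReal_norm_multiplier_sq {m : Plane → ℂ} {f : L2 𝕜}
    (h : MultiplierMem m f) :
    ENNReal.ofReal (‖multiplier m f‖ ^ 2) = ∫⁻ ζ, ‖m ζ * hat f ζ‖ₑ ^ 2 := by
  have e : 𝓕 (multiplier m f) = MemLp.toLp (fun ζ : Plane => m ζ * hat f ζ) h := by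
    rw [multiplier, dif_pos h, FourierTransform.fourier_fourierInv_eq]
  rw [← Lp.norm_fourier_eq, e, ← lintegral_enorm_sq]
  apply lintegral_congr_ae
  filter_upwards [MemLp.coeFn_toLp h] with ζ hζ
  rw [hζ]

theorem measurable_symbolA : Measurable symbolA := by
  unfold symbolA symbolDx; fun_prop

theorem measurable_symbolB : Measurable symbolB := by
  unfold symbolB symbolDx symbolPartialY; fun_prop

theorem measurable_symbolC : Measurable symbolC := by
  unfold symbolC symbolPartialX symbolPartialY; fun_prop

theorem ofReal_XNorm_sq {lam mu : ℝ} (hlam : 0 ≤ lam) (hmu : 0 ≤ mu) {f : L2 𝕜}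
    (hf : f ∈ XSpace 𝕜 lam mu) :
    ENNReal.ofReal (XNorm lam mu f ^ 2) =
      (∫⁻ ζ, ‖hat f ζ‖ₑ ^ 2) + (∫⁻ ζ, ‖symbolA ζ * hat f ζ‖ₑ ^ 2) +
        ENNReal.ofReal lam * (∫⁻ ζ, ‖symbolB ζ * hat f ζ‖ₑ ^ 2) +
        ENNReal.ofReal mu * ∫⁻ ζ, ‖symbolC ζ * hat f ζ‖ₑ ^ 2 := by
  obtain ⟨hA, hB, hC⟩ := hf
  have eB : ENNReal.ofReal lam * ENNReal.ofReal (‖multiplier symbolB f‖ ^ 2) =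
      ENNReal.ofReal lam * (∫⁻ ζ, ‖symbolB ζ * hat f ζ‖ₑ ^ 2) := by
    -- For `lam = 0` the integral may be infinite and the multiplier may take its default value 0;
    -- the coefficient annihilates both, since `0 * ⊤ = 0`.
    by_cases h : lam = 0
    · rw [h, ENNReal.ofReal_zero, zero_mul, zero_mul]
    · rw [(hB h).ofReal_norm_multiplier_sq]
  have eC : ENNReal.ofReal mu * ENNReal.ofReal (‖multiplier symbolC f‖ ^ 2) =
      ENNReal.ofReal mu * (∫⁻ ζ, ‖symbolC ζ * hat f ζ‖ₑ ^ 2) := by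
    by_cases h : mu = 0
    · rw [h, ENNReal.ofReal_zero, zero_mul, zero_mul]
    · rw [(hC h).ofReal_norm_multiplier_sq]
  rw [XNorm, Real.sq_sqrt (by positivity), ENNReal.ofReal_add (by positivity) (by positivity),
    ENNReal.ofReal_add (by positivity) (by positivity),
    ENNReal.ofReal_add (by positivity) (by positivity), ENNReal.ofReal_mul hlam,
    ENNReal.ofReal_mul hmu, hA.ofReal_norm_multiplier_sq, lintegral_enorm_sq, norm_hat, eB, eC]

theorem XNorm_nonneg (lam mu : ℝ) (f : L2 𝕜) : 0 ≤ XNorm lam mu f := Real.sqrt_nonneg _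

theorem XNormOn_nonneg (lam mu : ℝ) (Ω : Set Plane) (f : L2On 𝕜 Ω) :
    0 ≤ XNormOn lam mu Ω f := by
  apply Real.sInf_nonneg
  rintro t ⟨g, -, -, rfl⟩
  exact XNorm_nonneg _ _ _

theorem XNormOn_le {lam mu : ℝ} {Ω : Set Plane} {f : L2On 𝕜 Ω} {g : L2 𝕜}
    (hg : g ∈ XSpace 𝕜 lam mu) (hgf : restrictL2 Ω g = f) :
    XNormOn lam mu Ω f ≤ XNorm lam mu g := by
  refine csInf_le ⟨0, ?_⟩ ⟨g, hg, hgf, rfl⟩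
  rintro t ⟨g, -, -, rfl⟩
  exact XNorm_nonneg _ _ _

theorem restrictL2_eq {Ω : Set Plane} (hΩ : MeasurableSet Ω) {f g : L2 𝕜}
    (h : ∀ᵐ z, z ∈ Ω → f z = g z) : restrictL2 Ω f = restrictL2 Ω g := by
  apply Lp.ext
  have h' := (ae_restrict_iff' hΩ).2 h
  have h1 : restrictL2 Ω f =ᵐ[volume.restrict Ω] f := LpToLpRestrictCLM_coeFn 𝕜 Ω f
  have h2 : restrictL2 Ω g =ᵐ[volume.restrict Ω] g := LpToLpRestrictCLM_coeFn 𝕜 Ω g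
  exact (h1.trans h').trans h2.symm

theorem measurableSet_square (c : Plane) (R : ℝ) : MeasurableSet (square c R) := by
  have : square c R = ⋂ j : Fin 2, (fun z : Plane => z j) ⁻¹' Set.Ioo (c j) (c j + R) := by
    ext z; simp [square]
  rw [this]
  exact MeasurableSet.iInter fun j => measurableSet_Ioo.preimage (by fun_prop)

theorem norm_sub_squareCenter_le {c z : Plane} {R : ℝ} (hz : z ∈ square c R) :
    ‖z - squareCenter c R‖ ≤ R := by
  have hj : ∀ j, (z j - (c j + R / 2)) ^ 2 ≤ (R / 2) ^ 2 := fun j =>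
    sq_le_sq' (by linarith [(hz j).1]) (by linarith [(hz j).2])
  have hR : 0 ≤ R := by linarith [(hz 0).1, (hz 0).2]
  rw [EuclideanSpace.norm_eq]
  apply Real.sqrt_le_iff.2 ⟨hR, ?_⟩
  simp only [Fin.sum_univ_two, Real.norm_eq_abs, sq_abs, PiLp.sub_apply, squareCenter_apply]
  nlinarith [hj 0, hj 1, sq_nonneg R]

/-- A shift by `3R` moves the square to horizontal distance at least `5R/2` from its center, outside
the support of the cutoff. -/
theorem le_norm_sub_shiftVec_sub_squareCenter {c z : Plane} {R : ℝ} (hz : z ∈ square c R) :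
    2 * R ≤ ‖z - shiftVec (3 * R) - squareCenter c R‖ := by
  have h1 : ‖(z - shiftVec (3 * R) - squareCenter c R) 0‖ ≤
      ‖z - shiftVec (3 * R) - squareCenter c R‖ := PiLp.norm_apply_le _ 0
  refine le_trans ?_ h1
  have e : (z - shiftVec (3 * R) - squareCenter c R) 0 = z 0 - 3 * R - (c 0 + R / 2) := by
    simp [squareCenter_apply, shiftVec, unitVec]
  rw [e, Real.norm_eq_abs, le_abs]
  right
  linarith [(hz 0).1, (hz 0).2]

theorem summable_and_tsum_le_of_ofReal {f : ℕ → ℝ} (hf : ∀ i, 0 ≤ f i) {B : ℝ} (hB : 0 ≤ B)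
    (h : ∑' i, ENNReal.ofReal (f i) ≤ ENNReal.ofReal B) : Summable f ∧ ∑' i, f i ≤ B := by
  have hs : Summable f := by
    have := ENNReal.summable_toReal (h.trans_lt ENNReal.ofReal_lt_top).ne
    simpa [ENNReal.toReal_ofReal, hf] using this
  refine ⟨hs, ?_⟩
  rwa [← ENNReal.ofReal_tsum_of_nonneg hf hs, ENNReal.ofReal_le_ofReal_iff hB] at h

/-- If `ĝ_i = (1 - σ) (χ_i u)^` for the symbol `σ` of a horizontal translation and cutoffs `χ_i` with
bounded overlap, then `∑ ‖g_i‖_X² ≤ C ‖u‖_X²`. -/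
theorem tsum_ofReal_XNorm_sq_le {lam mu : ℝ} (hlam : 0 ≤ lam) (hmu : 0 ≤ mu)
    {χ : ℕ → 𝓢(Plane, ℂ)} {K : ℝ≥0∞} (hK : K ≠ ⊤)
    (hχ : ∀ z, ∑' i, ‖χ i z‖ₑ ^ 2 ≤ K)
    (hχ' : ∀ j z, ∑' i, ‖(∂_{unitVec j} (χ i)) z‖ₑ ^ 2 ≤ K) {L : ℝ} (hL : 0 ≤ L)
    {u : L2 𝕜} (hu : u ∈ XSpace 𝕜 lam mu) {g : ℕ → L2 𝕜}
    (hg : ∀ i, hat (g i) =ᵐ[volume] fun ζ =>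
      (1 - shiftSymbol (shiftVec L) ζ) * (𝓕 (cut (χ i) (toComplex u)) : L2 ℂ) ζ) :
    (∀ i, g i ∈ XSpace 𝕜 lam mu) ∧
      ∑' i, ENNReal.ofReal (XNorm lam mu (g i) ^ 2) ≤
        (2 + ENNReal.ofReal lam + ENNReal.ofReal mu) * (16 * ENNReal.ofReal (4 + L ^ 2) * K) *
          ENNReal.ofReal (XNorm lam mu u ^ 2) := by
  set D : ℝ≥0∞ := 16 * ENNReal.ofReal (4 + L ^ 2) * K with hD
  have hDtop : D ≠ ⊤ := by finiteness
  have h0 : ∑' i, ∫⁻ ζ, ‖hat (g i) ζ‖ₑ ^ 2 ≤ D * ∫⁻ ζ, ‖hat u ζ‖ₑ ^ 2 :=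
    tsum_lintegral_localization_le hχ hg
  have hA : ∑' i, ∫⁻ ζ, ‖symbolA ζ * hat (g i) ζ‖ₑ ^ 2 ≤
      D * ((∫⁻ ζ, ‖hat u ζ‖ₑ ^ 2) + ∫⁻ ζ, ‖symbolA ζ * hat u ζ‖ₑ ^ 2) :=
    tsum_lintegral_symbolA_localization_le hχ hχ' hg
  have hB : lam ≠ 0 → ∑' i, ∫⁻ ζ, ‖symbolB ζ * hat (g i) ζ‖ₑ ^ 2 ≤
      D * ((∫⁻ ζ, ‖hat u ζ‖ₑ ^ 2) + ∫⁻ ζ, ‖symbolB ζ * hat u ζ‖ₑ ^ 2) := fun h =>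
    tsum_lintegral_symbolB_localization_le hχ hχ' hL hg (hu.2.1 h)
  have hC : mu ≠ 0 → ∑' i, ∫⁻ ζ, ‖symbolC ζ * hat (g i) ζ‖ₑ ^ 2 ≤
      D * ((∫⁻ ζ, ‖hat u ζ‖ₑ ^ 2) + ∫⁻ ζ, ‖symbolC ζ * hat u ζ‖ₑ ^ 2) := fun h =>
    tsum_lintegral_symbolC_localization_le hχ hχ' hL hg (hu.2.2 h)
  have fin0 : ∫⁻ ζ, ‖hat u ζ‖ₑ ^ 2 < ⊤ := by
    rw [lintegral_enorm_sq]; exact ENNReal.ofReal_lt_top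
  -- Membership of each `g i` is read off from the finiteness of the whole sum.
  have mem : ∀ {m : Plane → ℂ}, Measurable m → MultiplierMem m u →
      ∑' i, ∫⁻ ζ, ‖m ζ * hat (g i) ζ‖ₑ ^ 2 ≤
        D * ((∫⁻ ζ, ‖hat u ζ‖ₑ ^ 2) + ∫⁻ ζ, ‖m ζ * hat u ζ‖ₑ ^ 2) →
      ∀ i, MultiplierMem m (g i) := fun hm hmu h i =>
    MultiplierMem.of_lintegral_lt_top hm (((ENNReal.le_tsum i).trans h).trans_lt
      (ENNReal.mul_lt_top hDtop.lt_top (ENNReal.add_lt_top.2 ⟨fin0, hmu.lintegral_lt_top⟩)))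
  have hgX : ∀ i, g i ∈ XSpace 𝕜 lam mu := fun i =>
    ⟨mem measurable_symbolA hu.1 hA i,
      fun h => mem measurable_symbolB (hu.2.1 h) (hB h) i,
      fun h => mem measurable_symbolC (hu.2.2 h) (hC h) i⟩
  refine ⟨hgX, ?_⟩
  simp_rw [ofReal_XNorm_sq hlam hmu (hgX _), ofReal_XNorm_sq hlam hmu hu]
  rw [ENNReal.tsum_add, ENNReal.tsum_add, ENNReal.tsum_add, ENNReal.tsum_mul_left,
    ENNReal.tsum_mul_left]
  have hB' : ENNReal.ofReal lam * ∑' i, ∫⁻ ζ, ‖symbolB ζ * hat (g i) ζ‖ₑ ^ 2 ≤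
      ENNReal.ofReal lam *
        (D * ((∫⁻ ζ, ‖hat u ζ‖ₑ ^ 2) + ∫⁻ ζ, ‖symbolB ζ * hat u ζ‖ₑ ^ 2)) := by
    by_cases h : lam = 0
    · rw [h, ENNReal.ofReal_zero, zero_mul, zero_mul]
    · exact mul_le_mul' le_rfl (hB h)
  have hC' : ENNReal.ofReal mu * ∑' i, ∫⁻ ζ, ‖symbolC ζ * hat (g i) ζ‖ₑ ^ 2 ≤
      ENNReal.ofReal mu *
        (D * ((∫⁻ ζ, ‖hat u ζ‖ₑ ^ 2) + ∫⁻ ζ, ‖symbolC ζ * hat u ζ‖ₑ ^ 2)) := by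
    by_cases h : mu = 0
    · rw [h, ENNReal.ofReal_zero, zero_mul, zero_mul]
    · exact mul_le_mul' le_rfl (hC h)
  refine (add_le_add (add_le_add (add_le_add h0 hA) hB') hC').trans ?_
  generalize (∫⁻ ζ, ‖hat u ζ‖ₑ ^ 2) = n0
  generalize (∫⁻ ζ, ‖symbolA ζ * hat u ζ‖ₑ ^ 2) = nA
  generalize (∫⁻ ζ, ‖symbolB ζ * hat u ζ‖ₑ ^ 2) = nB
  generalize (∫⁻ ζ, ‖symbolC ζ * hat u ζ‖ₑ ^ 2) = nC
  generalize ENNReal.ofReal lam = l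
  generalize ENNReal.ofReal mu = m
  -- Each of the four bounds contributes one `n0`, with total weight `2 + l + m`.
  calc D * n0 + D * (n0 + nA) + l * (D * (n0 + nB)) + m * (D * (n0 + nC))
      = (2 + l + m) * D * n0 + 1 * D * (nA + l * nB + m * nC) := by ring
    _ ≤ (2 + l + m) * D * n0 + (2 + l + m) * D * (nA + l * nB + m * nC) := by
        gcongr
        rw [add_assoc]
        exact le_add_right (by norm_num)
    _ = _ := by ring

/-! ### The cutoff and the conclusion -/

theorem exists_cutoff {R : ℝ} (hR : 0 < R) : ∃ (b : Plane → ℝ) (ψ : 𝓢(Plane, ℂ)), Continuous b ∧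
    (∀ z, ψ z = b z) ∧ tsupport ψ ⊆ Metric.closedBall 0 (2 * R) ∧ (∀ z, ‖z‖ ≤ R → b z = 1) ∧
    ∀ z, 2 * R ≤ ‖z‖ → b z = 0 := by
  let b : ContDiffBump (0 : Plane) := ⟨R, 2 * R, hR, by linarith⟩
  have hc : HasCompactSupport (fun z => (b z : ℂ)) :=
    b.hasCompactSupport.comp_left (g := fun r : ℝ => (r : ℂ)) rfl
  refine ⟨b, hc.toSchwartzMap (Complex.ofRealCLM.contDiff.comp b.contDiff), b.continuous,
    fun z => rfl, ?_, fun z hz => ?_, fun z hz => ?_⟩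
  · rw [← b.tsupport_eq]
    apply closure_mono
    intro z hz h0
    exact hz (by change ((b z : ℝ) : ℂ) = 0; rw [h0]; rfl)
  · exact b.one_of_mem_closedBall (by simpa using hz)
  · exact b.zero_of_le_dist (by simpa using hz)

end AnisotropicX

open AnisotropicX in
theorem mainTheorem5 {𝕜 : Type*} [RCLike 𝕜] (lam mu : ℝ) (hlam : 0 ≤ lam) (hmu : 0 ≤ mu)
    (hne : ¬ (lam = 0 ∧ mu = 0)) (R : ℝ) (hR : 0 < R) :
    ∃ C : ℝ, 0 < C ∧
      ∀ c : ℕ → AnisotropicX.Plane,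
        (⋃ i, AnisotropicX.square (c i) R) = Set.univ →
        (∀ z : AnisotropicX.Plane, {i : ℕ | z ∈ AnisotropicX.square (c i) R}.encard ≤ 3) →
        ∀ u ∈ AnisotropicX.XSpace 𝕜 lam mu,
          (∀ i, AnisotropicX.restrictL2 (AnisotropicX.square (c i) R) u ∈
            AnisotropicX.XSpaceOn 𝕜 lam mu (AnisotropicX.square (c i) R)) ∧
          Summable (fun i => AnisotropicX.XNormOn lam mu (AnisotropicX.square (c i) R)
            (AnisotropicX.restrictL2 (AnisotropicX.square (c i) R) u) ^ 2) ∧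
          ∑' i, AnisotropicX.XNormOn lam mu (AnisotropicX.square (c i) R)
            (AnisotropicX.restrictL2 (AnisotropicX.square (c i) R) u) ^ 2
            ≤ C * AnisotropicX.XNorm lam mu u ^ 2 := by
  obtain ⟨b, ψ, hb, hψb, hψ, hb1, hb0⟩ := exists_cutoff hR
  obtain ⟨K, hK, hKc⟩ := exists_uniform_cutoff_bound hR ψ hψ
  set D : ENNReal := (2 + ENNReal.ofReal lam + ENNReal.ofReal mu) *
    (16 * ENNReal.ofReal (4 + (3 * R) ^ 2) * K) with hD
  have hDtop : D ≠ ⊤ := by finiteness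
  -- The summand 1 makes the constant visibly positive.
  refine ⟨D.toReal + 1, by positivity, fun c _ hc u hu => ?_⟩
  obtain ⟨hχ, hχ'⟩ := hKc c hc
  choose g hg hgh using fun i => exists_eq_mul_cutoff_sub_shift u
    (SchwartzMap.compSubConstCLM ℂ (squareCenter (c i) R) ψ)
    (fun z => b (z - squareCenter (c i) R)) (by fun_prop) (fun z => hψb _) (shiftVec (3 * R))
  obtain ⟨hgX, hsum⟩ := tsum_ofReal_XNorm_sq_le hlam hmu hK hχ hχ' (by positivity) hu hgh
  have hres : ∀ i, restrictL2 (square (c i) R) (g i) = restrictL2 (square (c i) R) u := by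
    intro i
    apply restrictL2_eq (measurableSet_square _ _)
    filter_upwards [hg i] with z hz hzs
    -- On the square the cutoff is 1 and its translate is 0, so `g i` agrees with `u` there.
    rw [hz, hb1 _ (norm_sub_squareCenter_le hzs), hb0 _ (le_norm_sub_shiftVec_sub_squareCenter hzs)]
    simp
  refine ⟨fun i => ⟨g i, hgX i, hres i⟩, ?_⟩
  apply summable_and_tsum_le_of_ofReal (fun i => sq_nonneg _) (by positivity)
  calc _ ≤ ∑' i, ENNReal.ofReal (XNorm lam mu (g i) ^ 2) := by
        refine ENNReal.tsum_le_tsum fun i => ENNReal.ofReal_le_ofReal ?_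
        exact pow_le_pow_left₀ (XNormOn_nonneg _ _ _ _) (XNormOn_le (hgX i) (hres i)) 2
    _ ≤ D * ENNReal.ofReal (XNorm lam mu u ^ 2) := hsum
    _ ≤ ENNReal.ofReal (D.toReal + 1) * ENNReal.ofReal (XNorm lam mu u ^ 2) := by
        gcongr
        exact (ENNReal.ofReal_toReal hDtop).symm.trans_le (ENNReal.ofReal_le_ofReal (by linarith))
    _ = _ := (ENNReal.ofReal_mul (by positivity)).symm
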